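/- Let $X\in\mathbb R^{d\times n}$ be a nonnegative matrix which is $k$-separable: there are an index set $I\subseteq\{1,\dots,n\}$ of size $k$ and a nonnegative matrix $H\in\mathbb R^{k\times n}$ with $X=X_IH$, where $X_I$ consists of the columns of $X$ indexed by $I$, and the columns $x_i$, $i\in I$, are precisely the extreme points (each listed once) of the convex polytope $P=\operatorname{conv}\{x_1,\dots,x_n\}$ spanned by the columns of $X$. For $i\in I$ let $\omega_i$ be the solid angle of the normal cone $N_P(x_i)=\{w\in\mathbb R^d: w^T(y-x_i)\le 0\text{ for all }y\in P\}$, that is, the probability that a uniformly random point of the unit sphere $S^{d-1}$ lies in $N_P(x_i)$, and let $$\kappa=\frac{1}{k\log\bigl(1/\max_{i\in I}(1-2\omega_i)\bigr)}$$ be the condition number (with $\kappa=0$ in the degenerate cases $k\le 2$, in which $\max_{i}(1-2\omega_i)\le 0$). For integers $m,B\ge 1$ let $T=GS$, where $G$ is an $m\times B$ matrix with i.i.d. $N(0,1)$ entries and $S$ is a $B\times d$ CountSketch matrix independent of $G$: every column of $S$ has exactly one nonzero entry, in a uniformly random position, with value $+1$ or $-1$ with probability $1/2$ each, all these choices being independent.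 The CountGauss NMF algorithm computes $Z=TX$ and outputs $I_{\max}\cup I_{\min}$, where $I_{\max}$ (resp. $I_{\min}$) is the set of all indices $j$ such that $Z_{rj}$ is the maximum (resp. minimum) of the $r$-th row of $Z$ for some $r\in\{1,\dots,m\}$. **Theorem.** There is an absolute constant $C>1$ such that for all $d,n,k$, every such $X$ and $I$, every $\delta>0$, and all integers $m\ge1$, $B\ge 1$ with $$m\ \ge\ \kappa\,k\,\log\frac{k}{\delta},\qquad B\ \ge\ \frac1\delta\,C\,(\log d)^4\,n^2\,m^{1/2}$$ (in particular when $m\geq 1$ is $\kappa k\log(k/\delta)$ rounded up), one has $$\Pr\bigl[\,I\subseteq I_{\max}\cup I_{\min}\,\bigr]\ \ge\ 1-2\delta .$$ -/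

import Mathlib

open MeasureTheory ProbabilityTheory
open scoped Matrix

noncomputable section

namespace CountGauss

/-- The sample space of the transform: the entries of an `m × B` matrix, together with, for each of
the `d` columns of a `B × d` CountSketch matrix, the position and the sign of its nonzero entry. -/
abbrev Sample (m B d : ℕ) : Type :=
  (Fin m → Fin B → ℝ) × (Fin d → Fin B × Bool)

/-- The law of the random choices: the Gaussian entries are i.i.d. `N(0,1)`, the positions are
uniform in `{1, …, B}`, the signs are uniform, and all of these choices are independent. -/
def sampleLaw (m B d : ℕ) : Measure (Sample m B d) :=
  (Measure.pi fun _ : Fin m => Measure.pi fun _ : Fin B => gaussianReal 0 1).prod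
    (Measure.pi fun _ : Fin d =>
      (uniformOn (Set.univ : Set (Fin B))).prod (uniformOn (Set.univ : Set Bool)))

instance (m B d : ℕ) [NeZero B] : IsProbabilityMeasure (sampleLaw m B d) := by
  unfold sampleLaw; infer_instance

/-- The Gaussian matrix `G`. -/
def gaussianMatrix {m B d : ℕ} (ω : Sample m B d) : Matrix (Fin m) (Fin B) ℝ :=
  Matrix.of ω.1

/-- The CountSketch matrix `S`: column `j` has a single nonzero entry, equal to `1` or `-1`. -/
def countSketchMatrix {m B d : ℕ} (ω : Sample m B d) : Matrix (Fin B) (Fin d) ℝ :=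
  Matrix.of fun b j => if (ω.2 j).1 = b then (if (ω.2 j).2 then 1 else -1) else 0

/-- The CountGauss transform `T = G S`. -/
def transform {m B d : ℕ} (ω : Sample m B d) : Matrix (Fin m) (Fin d) ℝ :=
  gaussianMatrix ω * countSketchMatrix ω

/-- The indices at which some row of `Z` attains its maximum. -/
def argmaxIndices {m n : ℕ} (Z : Matrix (Fin m) (Fin n) ℝ) : Set (Fin n) :=
  {j | ∃ r, ∀ l, Z r l ≤ Z r j}

/-- The indices at which some row of `Z` attains its minimum. -/
def argminIndices {m n : ℕ} (Z : Matrix (Fin m) (Fin n) ℝ) : Set (Fin n) :=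
  {j | ∃ r, ∀ l, Z r j ≤ Z r l}

/-- The output `I_max ∪ I_min` of the CountGauss NMF algorithm on `X`. -/
def algorithmOutput {m B d n : ℕ} (X : Matrix (Fin d) (Fin n) ℝ) (ω : Sample m B d) :
    Set (Fin n) :=
  argmaxIndices (transform ω * X) ∪ argminIndices (transform ω * X)

/-- Column `j` of `X` as a point of Euclidean space. -/
def column {d n : ℕ} (X : Matrix (Fin d) (Fin n) ℝ) (j : Fin n) : EuclideanSpace ℝ (Fin d) :=
  WithLp.toLp 2 fun i => X i j

/-- The convex polytope defined by the columns of `X`. -/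
def polytope {d n : ℕ} (X : Matrix (Fin d) (Fin n) ℝ) : Set (EuclideanSpace ℝ (Fin d)) :=
  convexHull ℝ (Set.range (column X))

/-- `X` is nonnegative and `k`-separable with respect to the index set `I`: the set `I` has size
`k` and `X = X_I H` for some nonnegative `H`. -/
def IsSeparable {d n : ℕ} (X : Matrix (Fin d) (Fin n) ℝ) (k : ℕ) (I : Finset (Fin n)) : Prop :=
  I.card = k ∧ (∀ i j, 0 ≤ X i j) ∧
    ∃ H : Matrix I (Fin n) ℝ, (∀ i j, 0 ≤ H i j) ∧
      X = X.submatrix id (Subtype.val : I → Fin n) * H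

/-- `I` is the index set of the extreme points of the polytope of the columns of `X`: the columns
indexed by `I` are exactly the extreme points, each listed once. -/
def IsExtremeIndexSet {d n : ℕ} (X : Matrix (Fin d) (Fin n) ℝ) (I : Finset (Fin n)) : Prop :=
  Set.BijOn (column X) I ((polytope X).extremePoints ℝ)

/-- The normal cone of `C` at `x`. -/
def normalCone {d : ℕ} (C : Set (EuclideanSpace ℝ (Fin d))) (x : EuclideanSpace ℝ (Fin d)) :
    Set (EuclideanSpace ℝ (Fin d)) :=
  {w | ∀ y ∈ C, inner ℝ w (y - x) ≤ 0}

/-- The solid angle of a cone `K`: the probability that a uniformly random point of the unit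
sphere lies in `K`. -/
def solidAngle {d : ℕ} (K : Set (EuclideanSpace ℝ (Fin d))) : ℝ :=
  (volume : Measure (EuclideanSpace ℝ (Fin d))).toSphere.real {θ | (θ : EuclideanSpace ℝ (Fin d)) ∈ K} /
    (volume : Measure (EuclideanSpace ℝ (Fin d))).toSphere.real Set.univ

/-- The condition number `κ = 1 / (k log (1 / max_{i ∈ I} (1 - 2 ω_i)))`, where `k = |I|` and `ω_i`
is the solid angle of the normal cone of the polytope at column `i`. For a polytope with at least
three extreme points one has `0 < 1 - 2 ω_i < 1`. With one or two extreme points the maximum is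
`-1` or `0`, and the value of this expression is then `0`. -/
def conditionNumber {d n : ℕ} (X : Matrix (Fin d) (Fin n) ℝ) (I : Finset (Fin n)) : ℝ :=
  1 / ((I.card : ℝ) *
    Real.log (1 / ⨆ i : I, (1 - 2 * solidAngle (normalCone (polytope X) (column X i)))))

end CountGauss

end

/-!
Column `i` is output as soon as some row of the transform `GS` lies in the normal cone of the
polytope at `i` or in the negative of that cone. Were the rows standard Gaussian in `ℝ ^ d`, this
would have probability `2 ωᵢ` for each row by rotation invariance, and `m` independent rows would
all miss `i` with probability `(1 - 2 ωᵢ) ^ m ≤ δ / k`.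

A row of `GS` is instead a standard Gaussian of `ℝ ^ B` pulled back by `S`. The event depends only
on the restriction of `S` to the direction space `V` of the affine span of the columns, and there
the pulled back Gaussian has covariance close to the identity when the squared Hilbert–Schmidt
isometry defect `D` of `S` on `V` is small. Let `f` be the ratio of the two Gaussian densities.
Bounding `f` from below by `1 + log f`, and `log f` through a negative power moment of `f`, shows
that an event of probability `p` keeps probability at least `p (1 - O(√D (1 + log (1 / p))))`. The
mean of `D` over the sketches is at most `2 (dim V) ^ 2 / B`, which bounds the total failure
probability by `2 δ`.

With at most two extreme points, every linear functional is extremal at each of them.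
-/

open scoped ENNReal NNReal BigOperators RealInnerProductSpace

namespace CountGauss

section ProductMeasure

variable {ι : Type*} {E : ι → Type*} [∀ i, MeasurableSpace (E i)]
  (μ : (i : ι) → Measure (E i)) [∀ i, SigmaFinite (μ i)] {f : (i : ι) → E i → ℝ≥0∞}

theorem lmarginal_finset_prod [DecidableEq ι] (hf : ∀ i, Measurable (f i)) (s : Finset ι)
    (x : (i : ι) → E i) :
    lmarginal μ s (fun y => ∏ i ∈ s, f i (y i)) x = ∏ i ∈ s, ∫⁻ y, f i y ∂(μ i) := by
  have hmeas : ∀ t : Finset ι, Measurable fun y : (i : ι) → E i => ∏ i ∈ t, f i (y i) :=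
    fun t => Finset.measurable_prod t fun i _ => (hf i).comp (measurable_pi_apply i)
  induction s using Finset.induction_on with
  | empty => simp
  | insert i s hi ih =>
    have hupdate : ∀ (y : (i : ι) → E i) (z : E i),
        ∏ j ∈ s, f j (Function.update y i z j) = ∏ j ∈ s, f j (y j) := fun y z =>
      Finset.prod_congr rfl fun j hj => by
        rw [Function.update_of_ne (ne_of_mem_of_not_mem hj hi)]
    rw [lmarginal_insert' _ (hmeas _) hi]
    simp only [Finset.prod_insert hi, Function.update_self, hupdate]
    simp only [lintegral_mul_const _ (hf i)]
    rw [← ih]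
    exact lintegral_const_mul _ ((hmeas s).comp measurable_updateFinset)

variable [Fintype ι]

theorem lintegral_pi_prod (hf : ∀ i, Measurable (f i)) :
    ∫⁻ x, ∏ i, f i (x i) ∂(Measure.pi μ) = ∏ i, ∫⁻ y, f i y ∂(μ i) := by
  classical
  rcases isEmpty_or_nonempty ((i : ι) → E i) with hE | ⟨⟨x⟩⟩
  · obtain ⟨i, hi⟩ := isEmpty_pi.1 hE
    rw [lintegral_of_isEmpty, Finset.prod_eq_zero (Finset.mem_univ i) (lintegral_of_isEmpty _ _)]
  · rw [lintegral_eq_lmarginal_univ x, lmarginal_finset_prod μ hf]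

theorem pi_withDensity (hf : ∀ i, Measurable (f i)) [∀ i, SigmaFinite ((μ i).withDensity (f i))] :
    Measure.pi (fun i => (μ i).withDensity (f i)) =
      (Measure.pi μ).withDensity fun x => ∏ i, f i (x i) := by
  classical
  refine Measure.pi_eq fun s hs => ?_
  have hindicator : (Set.univ.pi s).indicator (fun x => ∏ i, f i (x i)) =
      fun x => ∏ i, (s i).indicator (f i) (x i) := by
    funext x
    simp only [Set.indicator_apply, Set.mem_univ_pi, Finset.prod_ite_zero, Finset.mem_univ,
      true_imp_iff]
  rw [withDensity_apply _ (MeasurableSet.univ_pi hs),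
    ← lintegral_indicator (MeasurableSet.univ_pi hs), hindicator,
    lintegral_pi_prod μ fun i => (hf i).indicator (hs i)]
  simp only [lintegral_indicator (hs _), withDensity_apply _ (hs _)]

end ProductMeasure

theorem mul_one_sub_le_setIntegral {Ω : Type*} [MeasurableSpace Ω] {γ : Measure Ω}
    [IsProbabilityMeasure γ] {f : Ω → ℝ} {s M : ℝ} (hs : 0 < s) (hf : ∀ x, 0 < f x)
    (hint : Integrable f γ) (hint_rpow : Integrable (fun x => f x ^ (-s)) γ)
    (hM : ∫ x, f x ^ (-s) ∂γ ≤ M) (K : Set Ω) :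
    γ.real K * (1 - s⁻¹ * (Real.log (1 / γ.real K) - 1 + M)) ≤ ∫ x in K, f x ∂γ := by
  rcases (measureReal_nonneg : 0 ≤ γ.real K).eq_or_lt with hzero | hpos
  · rw [← hzero, zero_mul]
    exact integral_nonneg fun x => (hf x).le
  set a := Real.log (1 / γ.real K)
  have hexp : γ.real K = Real.exp (-a) := by
    rw [Real.exp_neg, Real.exp_log (one_div_pos.2 hpos), one_div, inv_inv]
  -- `log (f x) ≤ f x - 1` and `1 + t ≤ exp t` at `t = -s * log (f x) - a`
  have hpointwise : ∀ x, 1 - s⁻¹ * (a - 1) - s⁻¹ * γ.real K * f x ^ (-s) ≤ f x := fun x => by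
    have hlog := Real.log_le_sub_one_of_pos (hf x)
    have hrpow : γ.real K * f x ^ (-s) = Real.exp (-s * Real.log (f x) - a) := by
      rw [Real.rpow_def_of_pos (hf x), hexp, ← Real.exp_add]
      ring_nf
    have htangent := Real.add_one_le_exp (-s * Real.log (f x) - a)
    rw [← hrpow] at htangent
    have hscaled := mul_le_mul_of_nonneg_left htangent (inv_nonneg.2 hs.le)
    have hcancel : s⁻¹ * (-s * Real.log (f x)) = -Real.log (f x) := by field_simp
    linarith
  have hint_const := integrable_const (μ := γ) (1 - s⁻¹ * (a - 1))
  have hint_mul := hint_rpow.const_mul (s⁻¹ * γ.real K)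
  have hKM : ∫ x in K, f x ^ (-s) ∂γ ≤ M :=
    (setIntegral_le_integral hint_rpow
      (ae_of_all _ fun x => (Real.rpow_pos_of_pos (hf x) _).le)).trans hM
  calc γ.real K * (1 - s⁻¹ * (a - 1 + M))
      = γ.real K * (1 - s⁻¹ * (a - 1)) - s⁻¹ * γ.real K * M := by ring
    _ ≤ γ.real K * (1 - s⁻¹ * (a - 1)) - s⁻¹ * γ.real K * ∫ x in K, f x ^ (-s) ∂γ := by gcongr
    _ = ∫ x in K, (1 - s⁻¹ * (a - 1) - s⁻¹ * γ.real K * f x ^ (-s)) ∂γ := by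
      rw [integral_sub hint_const.integrableOn hint_mul.integrableOn, setIntegral_const,
        integral_const_mul, smul_eq_mul]
    _ ≤ ∫ x in K, f x ∂γ :=
      integral_mono (hint_const.sub hint_mul).integrableOn hint.integrableOn hpointwise

/-- The density of `N(0, v)` with respect to `N(0, 1)`, for `0 < v`. -/
noncomputable def gaussianRatio (v x : ℝ) : ℝ := (√v)⁻¹ * Real.exp (-(x ^ 2 / 2) * (v⁻¹ - 1))

theorem gaussianRatio_pos {v : ℝ} (hv : 0 < v) (x : ℝ) : 0 < gaussianRatio v x := by
  unfold gaussianRatio; positivity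

theorem measurable_gaussianRatio (v : ℝ) : Measurable (gaussianRatio v) := by
  unfold gaussianRatio; fun_prop

theorem gaussianPDFReal_eq_mul_gaussianRatio {v : ℝ≥0} (hv : v ≠ 0) (x : ℝ) :
    gaussianPDFReal 0 v x = gaussianPDFReal 0 1 x * gaussianRatio v x := by
  have hv' : (v : ℝ) ≠ 0 := NNReal.coe_ne_zero.2 hv
  have hexp : -(x - 0) ^ 2 / (2 * (v : ℝ)) =
      -(x - 0) ^ 2 / (2 * ((1 : ℝ≥0) : ℝ)) + -(x ^ 2 / 2) * ((v : ℝ)⁻¹ - 1) := by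
    rw [NNReal.coe_one]
    field_simp
    ring
  rw [gaussianPDFReal, gaussianPDFReal, gaussianRatio, hexp, Real.exp_add,
    Real.sqrt_mul (by positivity), NNReal.coe_one, mul_one, mul_inv]
  ring_nf

theorem gaussianReal_eq_withDensity_gaussianRatio {v : ℝ≥0} (hv : v ≠ 0) :
    gaussianReal 0 v =
      (gaussianReal 0 1).withDensity fun x => ENNReal.ofReal (gaussianRatio v x) := by
  rw [gaussianReal_of_var_ne_zero 0 hv, gaussianReal_of_var_ne_zero 0 one_ne_zero,
    ← withDensity_mul₀ (measurable_gaussianPDF 0 1).aemeasurable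
      (measurable_gaussianRatio v).ennreal_ofReal.aemeasurable]
  congr 1
  funext x
  rw [Pi.mul_apply, gaussianPDF, gaussianPDF, ← ENNReal.ofReal_mul (gaussianPDFReal_nonneg _ _ _),
    gaussianPDFReal_eq_mul_gaussianRatio hv]

theorem gaussianReal_map_sqrt_mul {v : ℝ} (hv : 0 < v) :
    (gaussianReal 0 1).map (fun x => √v * x) =
      (gaussianReal 0 1).withDensity fun x => ENNReal.ofReal (gaussianRatio v x) := by
  lift v to ℝ≥0 using hv.le
  rw [← gaussianReal_eq_withDensity_gaussianRatio (NNReal.coe_pos.1 hv).ne',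
    gaussianReal_map_const_mul, mul_zero, mul_one]
  congr 1
  exact NNReal.eq (Real.sq_sqrt v.2)

theorem gaussianPDFReal_smul_exp_sq (c x : ℝ) :
    gaussianPDFReal 0 1 x • Real.exp (-(c * x ^ 2 / 2)) =
      (√(2 * Real.pi))⁻¹ * Real.exp (-((1 + c) / 2) * x ^ 2) := by
  rw [gaussianPDFReal, smul_eq_mul, mul_assoc, ← Real.exp_add, NNReal.coe_one, mul_one]
  ring_nf

theorem integrable_exp_sq_gaussianReal {c : ℝ} (hc : 0 < 1 + c) :
    Integrable (fun x : ℝ => Real.exp (-(c * x ^ 2 / 2))) (gaussianReal 0 1) := by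
  rw [gaussianReal_of_var_ne_zero 0 one_ne_zero,
    integrable_withDensity_iff_integrable_smul' (measurable_gaussianPDF 0 1)
      (ae_of_all _ fun x => gaussianPDF_lt_top)]
  simp only [toReal_gaussianPDF, gaussianPDFReal_smul_exp_sq]
  exact (integrable_exp_neg_mul_sq (half_pos hc)).const_mul _

theorem integral_exp_sq_gaussianReal {c : ℝ} (hc : 0 < 1 + c) :
    ∫ x, Real.exp (-(c * x ^ 2 / 2)) ∂(gaussianReal 0 1) = (√(1 + c))⁻¹ := by
  rw [integral_gaussianReal_eq_integral_smul one_ne_zero]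
  simp only [gaussianPDFReal_smul_exp_sq]
  rw [integral_const_mul, integral_gaussian, ← Real.sqrt_inv, ← Real.sqrt_mul (by positivity),
    ← Real.sqrt_inv]
  congr 1
  field_simp

theorem gaussianRatio_rpow_neg {v : ℝ} (hv : 0 < v) (s x : ℝ) :
    gaussianRatio v x ^ (-s) =
      Real.exp (s / 2 * Real.log v) * Real.exp (-((-s * (v⁻¹ - 1)) * x ^ 2 / 2)) := by
  rw [gaussianRatio, Real.mul_rpow (by positivity) (by positivity), ← Real.exp_mul,
    Real.sqrt_eq_rpow, ← Real.rpow_neg hv.le, ← Real.rpow_mul hv.le, Real.rpow_def_of_pos hv]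
  ring_nf

theorem integrable_gaussianRatio {v : ℝ} (hv : 0 < v) :
    Integrable (gaussianRatio v) (gaussianReal 0 1) := by
  have hrpow : ∀ x, gaussianRatio v x = gaussianRatio v x ^ (-(-1) : ℝ) := fun x => by
    rw [neg_neg, Real.rpow_one]
  have hexponent : 0 < 1 + -(-1) * (v⁻¹ - 1) := by linarith [inv_pos.2 hv]
  refine ((integrable_exp_sq_gaussianReal hexponent).const_mul
    (Real.exp (-1 / 2 * Real.log v))).congr (ae_of_all _ fun x => ?_)
  rw [hrpow x, gaussianRatio_rpow_neg hv]

theorem neg_log_one_add_le {z : ℝ} (hz : |z| ≤ 1 / 4) :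
    -Real.log (1 + z) ≤ -z + 2 * z ^ 2 := by
  obtain ⟨hlower, -⟩ := abs_le.1 hz
  have hpos : 0 < 1 + z := by linarith
  have hinv : (1 + z)⁻¹ ≤ 1 - z + 2 * z ^ 2 := by
    rw [inv_le_iff_one_le_mul₀ hpos]
    nlinarith [sq_nonneg z, mul_nonneg (sq_nonneg z) (by linarith : 0 ≤ 1 / 4 + z)]
  linarith [Real.one_sub_inv_le_log_of_pos hpos]

theorem inv_le_two_of_abs_sub_one_le {v : ℝ} (hv : |v - 1| ≤ 1 / 2) : v⁻¹ ≤ 2 := by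
  have hv' : 1 / 2 ≤ v := by linarith [(abs_le.1 hv).1]
  calc v⁻¹ ≤ (1 / 2)⁻¹ := inv_anti₀ (by norm_num) hv'
    _ = 2 := by norm_num

theorem abs_neg_mul_inv_sub_one_le {v s : ℝ} (hs : 0 < s) (hv : |v - 1| ≤ 1 / 2) :
    |-s * (v⁻¹ - 1)| ≤ 2 * (s * |v - 1|) := by
  have hv0 : 0 < v := by linarith [(abs_le.1 hv).1]
  have hfactor : -s * (v⁻¹ - 1) = v⁻¹ * (s * (v - 1)) := by field_simp; ring
  rw [hfactor, abs_mul, abs_mul, abs_of_pos hs, abs_of_pos (inv_pos.2 hv0)]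
  gcongr
  exact inv_le_two_of_abs_sub_one_le hv

theorem integrable_gaussianRatio_rpow_neg {v s : ℝ} (hs : 0 < s) (hv : |v - 1| ≤ 1 / 2)
    (hsv : s * |v - 1| ≤ 1 / 8) :
    Integrable (fun x => gaussianRatio v x ^ (-s)) (gaussianReal 0 1) := by
  simp only [gaussianRatio_rpow_neg (by linarith [(abs_le.1 hv).1] : 0 < v)]
  have habs := (abs_le.1 (abs_neg_mul_inv_sub_one_le hs hv)).1
  exact (integrable_exp_sq_gaussianReal (by linarith)).const_mul _

theorem integral_gaussianRatio_rpow_neg_le {v s : ℝ} (hs : 0 < s) (hv : |v - 1| ≤ 1 / 2)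
    (hsv : s * |v - 1| ≤ 1 / 8) :
    ∫ x, gaussianRatio v x ^ (-s) ∂(gaussianReal 0 1) ≤
      Real.exp ((s + 4 * s ^ 2) * (v - 1) ^ 2) := by
  have hv0 : 0 < v := by linarith [(abs_le.1 hv).1]
  have hzabs := abs_neg_mul_inv_sub_one_le hs hv
  set z := -s * (v⁻¹ - 1) with hz
  have hz1 : 0 < 1 + z := by linarith [(abs_le.1 hzabs).1]
  have hzsq : z ^ 2 ≤ 4 * (s ^ 2 * (v - 1) ^ 2) := by
    calc z ^ 2 = |z| ^ 2 := (sq_abs z).symm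
      _ ≤ (2 * (s * |v - 1|)) ^ 2 := by gcongr
      _ = 4 * (s ^ 2 * (v - 1) ^ 2) := by rw [mul_pow, mul_pow, sq_abs]; ring
  -- the first-order terms of `s / 2 * log v` and `-log (1 + z) / 2` cancel
  have hfirst : s * (v - 1) - z ≤ 2 * (s * (v - 1) ^ 2) := by
    calc s * (v - 1) - z = v⁻¹ * (s * (v - 1) ^ 2) := by rw [hz]; field_simp; ring
      _ ≤ 2 * (s * (v - 1) ^ 2) := by gcongr; exact inv_le_two_of_abs_sub_one_le hv
  have hlog : s * Real.log v ≤ s * (v - 1) := by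
    gcongr
    exact Real.log_le_sub_one_of_pos hv0
  have hneg_log := neg_log_one_add_le (hzabs.trans (by linarith))
  simp only [gaussianRatio_rpow_neg hv0]
  rw [integral_const_mul, integral_exp_sq_gaussianReal hz1, ← Real.exp_log (Real.sqrt_pos.2 hz1),
    ← Real.exp_neg, Real.log_sqrt hz1.le, ← Real.exp_add]
  exact Real.exp_le_exp.2 (by linarith)

section Scaling

variable {ι : Type*} [Fintype ι] {v : ι → ℝ}

theorem pi_gaussianReal_map_sqrt_mul (hv : ∀ i, 0 < v i) :
    (Measure.pi fun _ : ι => gaussianReal 0 1).map (fun y i => √(v i) * y i) =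
      (Measure.pi fun _ : ι => gaussianReal 0 1).withDensity
        fun x => ENNReal.ofReal (∏ i, gaussianRatio (v i) (x i)) := by
  have hratio : ∀ i x, 0 ≤ gaussianRatio (v i) x := fun i x => (gaussianRatio_pos (hv i) x).le
  have hσ : ∀ i, SigmaFinite ((gaussianReal 0 1).withDensity
      fun x => ENNReal.ofReal (gaussianRatio (v i) x)) := fun i => by
    rw [← gaussianReal_map_sqrt_mul (hv i)]; infer_instance
  simp only [ENNReal.ofReal_prod_of_nonneg fun i _ => hratio i _]
  rw [← pi_withDensity (fun _ => gaussianReal 0 1)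
      (fun i => (measurable_gaussianRatio (v i)).ennreal_ofReal),
    Measure.pi_map_pi fun i => (measurable_const_mul (√(v i))).aemeasurable]
  simp only [gaussianReal_map_sqrt_mul (hv _)]

theorem prod_gaussianRatio_rpow_neg (hv : ∀ i, 0 < v i) (s : ℝ) (x : ι → ℝ) :
    (∏ i, gaussianRatio (v i) (x i)) ^ (-s) = ∏ i, gaussianRatio (v i) (x i) ^ (-s) :=
  (Real.finsetProd_rpow _ _ (fun i _ => (gaussianRatio_pos (hv i) _).le) _).symm

theorem integral_prod_gaussianRatio_rpow_neg_le {s : ℝ} (hs : 0 < s) (hv : ∀ i, |v i - 1| ≤ 1 / 2)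
    (hsv : ∀ i, s * |v i - 1| ≤ 1 / 8) :
    ∫ x, ∏ i, gaussianRatio (v i) (x i) ^ (-s) ∂(Measure.pi fun _ : ι => gaussianReal 0 1) ≤
      Real.exp ((s + 4 * s ^ 2) * ∑ i, (v i - 1) ^ 2) := by
  have hv0 : ∀ i, 0 < v i := fun i => by linarith [(abs_le.1 (hv i)).1]
  rw [integral_fintype_prod_eq_prod (f := fun i x => gaussianRatio (v i) x ^ (-s)),
    Finset.mul_sum, Real.exp_sum]
  exact Finset.prod_le_prod
    (fun i _ => integral_nonneg fun x => (Real.rpow_pos_of_pos (gaussianRatio_pos (hv0 i) x) _).le)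
    fun i _ => integral_gaussianRatio_rpow_neg_le hs (hv i) (hsv i)

theorem abs_le_sqrt_sum_sq (a : ι → ℝ) (i : ι) : |a i| ≤ √(∑ i, a i ^ 2) :=
  Real.abs_le_sqrt <|
    Finset.single_le_sum (f := fun i => a i ^ 2) (fun _ _ => sq_nonneg _) (Finset.mem_univ i)

theorem setIntegral_prod_gaussianRatio_ge (hpos : 0 < √(∑ i, (v i - 1) ^ 2))
    (hsmall : √(∑ i, (v i - 1) ^ 2) ≤ 1 / 2) (K : Set (ι → ℝ)) :
    (Measure.pi fun _ : ι => gaussianReal 0 1).real K * (1 - 8 * √(∑ i, (v i - 1) ^ 2) *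
        (1 + Real.log (1 / (Measure.pi fun _ : ι => gaussianReal 0 1).real K))) ≤
      ∫ x in K, ∏ i, gaussianRatio (v i) (x i) ∂(Measure.pi fun _ : ι => gaussianReal 0 1) := by
  set γ := Measure.pi fun _ : ι => gaussianReal 0 1
  set D := √(∑ i, (v i - 1) ^ 2) with hD
  have habs : ∀ i, |v i - 1| ≤ D := abs_le_sqrt_sum_sq fun i => v i - 1
  have hhalf : ∀ i, |v i - 1| ≤ 1 / 2 := fun i => (habs i).trans hsmall
  have hv : ∀ i, 0 < v i := fun i => by linarith [(abs_le.1 (hhalf i)).1]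
  -- balances the factor `s⁻¹` of `mul_one_sub_le_setIntegral` against a moment bounded by `2`
  set s := (8 * D)⁻¹ with hs
  have hs0 : 0 < s := by positivity
  have hsD : s * D = 1 / 8 := by rw [hs]; field_simp
  have hsv : ∀ i, s * |v i - 1| ≤ 1 / 8 := fun i => by
    rw [← hsD]; gcongr; exact habs i
  have hmoment : ∫ x, (∏ i, gaussianRatio (v i) (x i)) ^ (-s) ∂γ ≤ 2 := by
    simp only [prod_gaussianRatio_rpow_neg hv]
    refine (integral_prod_gaussianRatio_rpow_neg_le hs0 hhalf hsv).trans ?_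
    rw [← Real.sq_sqrt (Finset.sum_nonneg fun i _ => sq_nonneg (v i - 1)), ← hD,
      ← Real.le_log_iff_exp_le two_pos]
    nlinarith [Real.log_two_gt_d9]
  have hint : Integrable (fun x : ι → ℝ => ∏ i, gaussianRatio (v i) (x i)) γ :=
    Integrable.fintype_prod fun i => integrable_gaussianRatio (hv i)
  have hint_rpow : Integrable (fun x => (∏ i, gaussianRatio (v i) (x i)) ^ (-s)) γ := by
    simp only [prod_gaussianRatio_rpow_neg hv]
    exact Integrable.fintype_prod fun i => integrable_gaussianRatio_rpow_neg hs0 (hhalf i) (hsv i)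
  refine le_of_eq_of_le ?_ <| mul_one_sub_le_setIntegral hs0
    (fun x => Finset.prod_pos fun i _ => gaussianRatio_pos (hv i) (x i)) hint hint_rpow hmoment K
  rw [hs, inv_inv]
  ring

theorem gaussian_real_preimage_scaling {K : Set (ι → ℝ)} (hK : MeasurableSet K)
    (hv : ∀ i, 0 < v i) :
    (Measure.pi fun _ : ι => gaussianReal 0 1).real {y | (fun i => √(v i) * y i) ∈ K} =
      ∫ x in K, ∏ i, gaussianRatio (v i) (x i) ∂(Measure.pi fun _ : ι => gaussianReal 0 1) := by
  have hscale : Measurable fun (y : ι → ℝ) i => √(v i) * y i := by fun_prop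
  have hmeas : Measurable fun x : ι → ℝ => ∏ i, gaussianRatio (v i) (x i) :=
    Finset.measurable_prod _ fun i _ =>
      (measurable_gaussianRatio (v i)).comp (measurable_pi_apply i)
  have hpreimage : {y : ι → ℝ | (fun i => √(v i) * y i) ∈ K} =
      (fun (y : ι → ℝ) i => √(v i) * y i) ⁻¹' K := rfl
  rw [integral_eq_lintegral_of_nonneg_ae
      (ae_of_all _ fun x => Finset.prod_nonneg fun i _ => (gaussianRatio_pos (hv i) (x i)).le)
      hmeas.aestronglyMeasurable,
    ← withDensity_apply _ hK, ← pi_gaussianReal_map_sqrt_mul hv, Measure.map_apply hscale hK,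
    measureReal_def, hpreimage]

theorem gaussian_scaling_ge {K : Set (ι → ℝ)} (hK : MeasurableSet K) (v : ι → ℝ) :
    (Measure.pi fun _ : ι => gaussianReal 0 1).real K * (1 - 8 * √(∑ i, (v i - 1) ^ 2) *
        (1 + Real.log (1 / (Measure.pi fun _ : ι => gaussianReal 0 1).real K))) ≤
      (Measure.pi fun _ : ι => gaussianReal 0 1).real {y | (fun i => √(v i) * y i) ∈ K} := by
  set γ := Measure.pi fun _ : ι => gaussianReal 0 1
  set D := √(∑ i, (v i - 1) ^ 2)
  have hlog : 0 ≤ Real.log (1 / γ.real K) := by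
    rw [one_div, Real.log_inv]
    exact neg_nonneg.2 (Real.log_nonpos measureReal_nonneg measureReal_le_one)
  rcases lt_or_ge (1 / 2) D with hlarge | hsmall
  · refine (mul_nonpos_of_nonneg_of_nonpos measureReal_nonneg ?_).trans measureReal_nonneg
    nlinarith
  have habs : ∀ i, |v i - 1| ≤ D := abs_le_sqrt_sum_sq fun i => v i - 1
  have hD : 0 ≤ D := Real.sqrt_nonneg _
  rcases hD.eq_or_lt with hzero | hpos
  · have hone : ∀ i, √(v i) = 1 := fun i => by
      rw [Real.sqrt_eq_one, ← sub_eq_zero, ← abs_nonpos_iff, hzero]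
      exact habs i
    simp only [hone, one_mul, ← hzero, mul_zero, zero_mul, sub_zero, mul_one]
    exact le_rfl
  · have hv : ∀ i, 0 < v i := fun i => by linarith [(abs_le.1 (habs i)).1]
    rw [gaussian_real_preimage_scaling hK hv]
    exact setIntegral_prod_gaussianRatio_ge hpos hsmall K

end Scaling

section IsometryDefect

variable {V W : Type*} [NormedAddCommGroup V] [InnerProductSpace ℝ V] [FiniteDimensional ℝ V]
  [NormedAddCommGroup W] [InnerProductSpace ℝ W] [FiniteDimensional ℝ W]

/-- The squared Hilbert–Schmidt norm of `R† R - 1`, which vanishes exactly when the linear map `R`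
is an isometry. -/
noncomputable def isometryDefect (R : V →ₗ[ℝ] W) : ℝ :=
  LinearMap.trace ℝ V ((R.adjoint ∘ₗ R - 1) ^ 2)

variable {ι : Type*} [Fintype ι] (R : V →ₗ[ℝ] W)

theorem isSymmetric_adjoint_comp_self_sub_one : (R.adjoint ∘ₗ R - 1).IsSymmetric :=
  R.isSymmetric_adjoint_comp_self.sub LinearMap.IsSymmetric.one

theorem isometryDefect_eq_sum_norm_sq (b : OrthonormalBasis ι ℝ V) :
    isometryDefect R = ∑ i, ‖(R.adjoint ∘ₗ R - 1) (b i)‖ ^ 2 := by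
  rw [isometryDefect, LinearMap.trace_eq_sum_inner _ b]
  refine Finset.sum_congr rfl fun i _ => ?_
  rw [sq, Module.End.mul_apply, ← isSymmetric_adjoint_comp_self_sub_one, real_inner_self_eq_norm_sq]

theorem isometryDefect_eq_sum_inner_sub_inner_sq (b : OrthonormalBasis ι ℝ V) :
    isometryDefect R = ∑ i, ∑ j, (⟪R (b i), R (b j)⟫ - ⟪b i, b j⟫) ^ 2 := by
  rw [isometryDefect_eq_sum_norm_sq R b, Finset.sum_comm]
  refine Finset.sum_congr rfl fun j _ => ?_
  rw [← b.sum_sq_inner_right]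
  simp only [LinearMap.sub_apply, LinearMap.comp_apply, Module.End.one_apply, inner_sub_right,
    LinearMap.adjoint_inner_right]

theorem isometryDefect_nonneg : 0 ≤ isometryDefect R := by
  rw [isometryDefect_eq_sum_norm_sq R (stdOrthonormalBasis ℝ V)]
  positivity

/-- The basis consists of right singular vectors of `R`, and the `c i` are the squares of its
singular values. -/
theorem exists_orthonormalBasis_map_orthogonal :
    ∃ (b : OrthonormalBasis (Fin (Module.finrank ℝ V)) ℝ V) (c : Fin (Module.finrank ℝ V) → ℝ),
      (∀ i, R.adjoint (R (b i)) = c i • b i) ∧ isometryDefect R = ∑ i, (c i - 1) ^ 2 := by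
  have hsymm := R.isSymmetric_adjoint_comp_self
  have heigen : ∀ i, R.adjoint (R (hsymm.eigenvectorBasis rfl i)) =
      hsymm.eigenvalues rfl i • hsymm.eigenvectorBasis rfl i := fun i =>
    hsymm.apply_eigenvectorBasis rfl i
  refine ⟨hsymm.eigenvectorBasis rfl, hsymm.eigenvalues rfl, heigen, ?_⟩
  rw [isometryDefect_eq_sum_norm_sq R (hsymm.eigenvectorBasis rfl)]
  refine Finset.sum_congr rfl fun i _ => ?_
  rw [LinearMap.sub_apply, LinearMap.comp_apply, heigen, Module.End.one_apply]
  nth_rw 2 [← one_smul ℝ (hsymm.eigenvectorBasis rfl i)]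
  rw [← sub_smul, norm_smul, OrthonormalBasis.norm_eq_one, mul_one, Real.norm_eq_abs, sq_abs]

theorem norm_sq_map_eq_sum {b : OrthonormalBasis ι ℝ V} {c : ι → ℝ}
    (hb : ∀ i, R.adjoint (R (b i)) = c i • b i) (t : V) :
    ‖R t‖ ^ 2 = ∑ i, c i * ⟪b i, t⟫ ^ 2 := by
  rw [← real_inner_self_eq_norm_sq, ← LinearMap.adjoint_inner_right, ← b.sum_inner_mul_inner]
  refine Finset.sum_congr rfl fun i _ => ?_
  rw [LinearMap.adjoint_inner_right, ← LinearMap.adjoint_inner_left, hb, inner_smul_left,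
    real_inner_comm, conj_trivial]
  ring

end IsometryDefect

section Gaussian

variable {V W W' : Type*} [NormedAddCommGroup V] [InnerProductSpace ℝ V] [FiniteDimensional ℝ V]
  [MeasurableSpace V] [BorelSpace V]
  [NormedAddCommGroup W] [InnerProductSpace ℝ W] [FiniteDimensional ℝ W]
  [MeasurableSpace W] [BorelSpace W]
  [NormedAddCommGroup W'] [InnerProductSpace ℝ W'] [FiniteDimensional ℝ W']
  [MeasurableSpace W'] [BorelSpace W']

theorem charFun_stdGaussian_map (L : W →ₗ[ℝ] V) (t : V) :
    charFun ((stdGaussian W).map L) t = Complex.exp (-‖L.adjoint t‖ ^ 2 / 2) := by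
  have hL : Continuous L := L.continuous_of_finiteDimensional
  rw [charFun_apply, integral_map hL.aemeasurable (by fun_prop)]
  simp only [← LinearMap.adjoint_inner_right]
  rw [← charFun_apply, charFun_stdGaussian]

theorem stdGaussian_map_eq_of_norm_adjoint_eq {L : W →ₗ[ℝ] V} {L' : W' →ₗ[ℝ] V}
    (h : ∀ t, ‖L.adjoint t‖ = ‖L'.adjoint t‖) :
    (stdGaussian W).map L = (stdGaussian W').map L' := by
  have := Measure.isProbabilityMeasure_map (μ := stdGaussian W)
    L.continuous_of_finiteDimensional.aemeasurable
  have := Measure.isProbabilityMeasure_map (μ := stdGaussian W')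
    L'.continuous_of_finiteDimensional.aemeasurable
  refine Measure.ext_of_charFun (funext fun t => ?_)
  rw [charFun_stdGaussian_map, charFun_stdGaussian_map, h]

theorem stdGaussian_map_adjoint_eq_map_pi {ι : Type*} [Fintype ι] (R : V →ₗ[ℝ] W)
    {b : OrthonormalBasis ι ℝ V} {c : ι → ℝ} (hc : ∀ i, 0 ≤ c i)
    (hb : ∀ i, R.adjoint (R (b i)) = c i • b i) :
    (stdGaussian W).map R.adjoint =
      (Measure.pi fun _ : ι => gaussianReal 0 1).map fun x => ∑ i, (√(c i) * x i) • b i := by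
  let D : V →ₗ[ℝ] EuclideanSpace ℝ ι :=
    { toFun t := WithLp.toLp 2 fun i => √(c i) * ⟪b i, t⟫
      map_add' s t := by ext i; simp only [inner_add_right, mul_add, PiLp.add_apply]
      map_smul' a t := by
        ext i
        simp only [inner_smul_right, mul_left_comm, PiLp.smul_apply, smul_eq_mul,
          RingHom.id_apply] }
  have hnorm : ∀ t, ‖R t‖ = ‖D t‖ := fun t => by
    rw [← sq_eq_sq₀ (norm_nonneg _) (norm_nonneg _), norm_sq_map_eq_sum R hb,
      EuclideanSpace.real_norm_sq_eq]
    exact Finset.sum_congr rfl fun i _ => by rw [← Real.sq_sqrt (hc i), ← mul_pow]; rfl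
  have hD : (fun x : ι → ℝ => ∑ i, (√(c i) * x i) • b i) = D.adjoint ∘ WithLp.toLp 2 := by
    funext x
    refine ext_inner_left ℝ fun t => ?_
    rw [Function.comp_apply, LinearMap.adjoint_inner_right, inner_sum, PiLp.inner_apply]
    refine Finset.sum_congr rfl fun i _ => ?_
    rw [inner_smul_right, real_inner_comm]
    simp only [D, LinearMap.coe_mk, AddHom.coe_mk, RCLike.inner_apply, conj_trivial]
    ring
  rw [hD, ← Measure.map_map D.adjoint.continuous_of_finiteDimensional.measurable (by fun_prop),
    map_pi_eq_stdGaussian]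
  refine stdGaussian_map_eq_of_norm_adjoint_eq fun t => ?_
  rw [LinearMap.adjoint_adjoint, LinearMap.adjoint_adjoint, hnorm]

theorem stdGaussian_preimage_adjoint_ge (R : V →ₗ[ℝ] W) {K : Set V} (hK : MeasurableSet K) :
    (stdGaussian V).real K *
        (1 - 8 * √(isometryDefect R) * (1 + Real.log (1 / (stdGaussian V).real K))) ≤
      (stdGaussian W).real (R.adjoint ⁻¹' K) := by
  obtain ⟨b, c, hb, hdefect⟩ := exists_orthonormalBasis_map_orthogonal R
  have hc : ∀ i, 0 ≤ c i := fun i => by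
    have hinner : ⟪b i, R.adjoint (R (b i))⟫ = c i := by
      rw [hb, inner_smul_right, real_inner_self_eq_norm_sq, b.norm_eq_one, one_pow, mul_one]
    rw [← hinner, LinearMap.adjoint_inner_right]
    exact real_inner_self_nonneg
  have hsynthesis : Measurable fun x : Fin (Module.finrank ℝ V) → ℝ => ∑ i, x i • b i := by
    fun_prop
  have hscaled : Measurable fun x : Fin (Module.finrank ℝ V) → ℝ => ∑ i, (√(c i) * x i) • b i := by
    fun_prop
  rw [← map_measureReal_apply R.adjoint.continuous_of_finiteDimensional.measurable hK,
    stdGaussian_map_adjoint_eq_map_pi R hc hb, map_measureReal_apply hscaled hK,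
    stdGaussian_eq_map_pi_orthonormalBasis b, map_measureReal_apply hsynthesis hK, hdefect]
  exact gaussian_scaling_ge (hsynthesis hK) c

end Gaussian

section PolarCoordinates

variable {E : Type*} [NormedAddCommGroup E] [NormedSpace ℝ E] [FiniteDimensional ℝ E] [Nontrivial E]
  [MeasurableSpace E] [BorelSpace E] (μ : Measure E) [μ.IsAddHaarMeasure]

theorem setLIntegral_norm_eq_toSphere_mul {K : Set E} (hK : MeasurableSet K)
    (hcone : ∀ c : ℝ, 0 < c → ∀ w, c • w ∈ K ↔ w ∈ K) {φ : ℝ → ℝ≥0∞} (hφ : Measurable φ) :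
    ∫⁻ w in K, φ ‖w‖ ∂μ = μ.toSphere {θ | (θ : E) ∈ K} *
      ∫⁻ ρ : Set.Ioi (0 : ℝ), φ ρ ∂(Measure.volumeIoiPow (Module.finrank ℝ E - 1)) := by
  set A : Set (Metric.sphere (0 : E) 1) := {θ | (θ : E) ∈ K} with hA_def
  have hA : MeasurableSet A := measurable_subtype_coe hK
  have hφ' : Measurable fun ρ : Set.Ioi (0 : ℝ) => φ ρ := hφ.comp measurable_subtype_coe
  have hpreimage : homeomorphUnitSphereProd E ⁻¹' (A ×ˢ Set.univ) =
      (Subtype.val : ({0}ᶜ : Set E) → E) ⁻¹' K := by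
    ext w
    simp only [Set.mem_preimage, Set.mem_prod, Set.mem_univ, and_true, hA_def, Set.mem_ofPred_eq,
      homeomorphUnitSphereProd_apply_fst_coe]
    exact hcone _ (inv_pos.2 (norm_pos_iff.2 w.2)) w
  calc ∫⁻ w in K, φ ‖w‖ ∂μ
      = ∫⁻ w in ({0}ᶜ : Set E), K.indicator (fun w => φ ‖w‖) w ∂μ := by
        rw [← lintegral_indicator hK,
          Measure.restrict_eq_self_of_ae_mem (s := {0}ᶜ) (compl_mem_ae_iff.2 (measure_singleton 0))]
    _ = ∫⁻ w in homeomorphUnitSphereProd E ⁻¹' (A ×ˢ Set.univ),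
          φ (homeomorphUnitSphereProd E w).2 ∂(μ.comap Subtype.val) := by
        rw [hpreimage, ← lintegral_indicator (measurable_subtype_coe hK),
          ← lintegral_subtype_comap (measurableSet_singleton (0 : E)).compl]
        simp only [homeomorphUnitSphereProd_apply_snd_coe]
        rfl
    _ = ∫⁻ p in A ×ˢ Set.univ, φ p.2
          ∂(μ.toSphere.prod (Measure.volumeIoiPow (Module.finrank ℝ E - 1))) :=
        μ.measurePreserving_homeomorphUnitSphereProd.setLIntegral_comp_preimage
          (hA.prod .univ) (hφ'.comp measurable_snd)
    _ = _ := by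
        have hprod := lintegral_prod_mul (μ := μ.toSphere.restrict A) (f := 1)
          (ν := Measure.volumeIoiPow (Module.finrank ℝ E - 1)) aemeasurable_const hφ'.aemeasurable
        rw [← Measure.prod_restrict, Measure.restrict_univ]
        simpa only [Pi.one_apply, one_mul, lintegral_const, Measure.restrict_apply_univ] using hprod

end PolarCoordinates

section GaussianDensity

variable {E : Type*} [NormedAddCommGroup E] [InnerProductSpace ℝ E] [FiniteDimensional ℝ E]
  [MeasurableSpace E] [BorelSpace E]

theorem map_withDensity_comp {α β : Type*} [MeasurableSpace α] [MeasurableSpace β] {μ : Measure α}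
    {ν : Measure β} {e : α → β} (he : MeasurePreserving e μ ν) {f : β → ℝ≥0∞} (hf : Measurable f) :
    (μ.withDensity (f ∘ e)).map e = ν.withDensity f := by
  ext s hs
  rw [Measure.map_apply he.measurable hs, withDensity_apply _ (he.measurable hs),
    withDensity_apply _ hs]
  exact he.setLIntegral_comp_preimage hs hf

theorem prod_gaussianPDF {ι : Type*} [Fintype ι] (x : EuclideanSpace ℝ ι) :
    ∏ i, gaussianPDF 0 1 (x i) =
      ENNReal.ofReal ((√(2 * Real.pi))⁻¹ ^ Fintype.card ι * Real.exp (-‖x‖ ^ 2 / 2)) := by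
  simp only [gaussianPDF]
  rw [← ENNReal.ofReal_prod_of_nonneg fun i _ => gaussianPDFReal_nonneg 0 1 _]
  simp only [gaussianPDFReal, Finset.prod_mul_distrib, Finset.prod_const, Finset.card_univ,
    ← Real.exp_sum, EuclideanSpace.real_norm_sq_eq, NNReal.coe_one, mul_one, sub_zero,
    ← Finset.sum_div, Finset.sum_neg_distrib]

theorem stdGaussian_eq_withDensity :
    stdGaussian E = volume.withDensity fun w : E => ENNReal.ofReal
      ((√(2 * Real.pi))⁻¹ ^ Module.finrank ℝ E * Real.exp (-‖w‖ ^ 2 / 2)) := by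
  let b := stdOrthonormalBasis ℝ E
  have hpreserving : MeasurePreserving
      (fun x : Fin (Module.finrank ℝ E) → ℝ => b.repr.symm (WithLp.toLp 2 x)) :=
    b.measurePreserving_repr_symm.comp
      (EuclideanSpace.volume_preserving_symm_measurableEquiv_toLp _).symm
  have hsum : (fun x : Fin (Module.finrank ℝ E) → ℝ => ∑ i, x i • b i) =
      fun x => b.repr.symm (WithLp.toLp 2 x) :=
    funext fun x => (b.sum_repr_symm (WithLp.toLp 2 x))
  rw [stdGaussian_eq_map_pi_orthonormalBasis b, hsum, ← map_withDensity_comp hpreserving]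
  · have : SigmaFinite (volume.withDensity (gaussianPDF 0 1)) := by
      rw [← gaussianReal_of_var_ne_zero 0 one_ne_zero]
      infer_instance
    congr 1
    simp only [gaussianReal_of_var_ne_zero 0 one_ne_zero]
    rw [pi_withDensity _ fun _ => measurable_gaussianPDF 0 1]
    refine congrArg _ (funext fun x => ?_)
    rw [prod_gaussianPDF (WithLp.toLp 2 x), Function.comp_apply, b.repr.symm.norm_map,
      Fintype.card_fin]
  · fun_prop

theorem volume_absolutelyContinuous_stdGaussian : (volume : Measure E) ≪ stdGaussian E := by
  rw [stdGaussian_eq_withDensity]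
  exact withDensity_absolutelyContinuous' (by fun_prop) (ae_of_all _ fun w => by positivity)

instance : (stdGaussian E).IsOpenPosMeasure :=
  volume_absolutelyContinuous_stdGaussian.isOpenPosMeasure

theorem stdGaussian_orthogonal_eq_zero {z : E} (hz : z ≠ 0) :
    stdGaussian E {w | ⟪w, z⟫ = 0} = 0 := by
  have hne : (ℝ ∙ z)ᗮ ≠ ⊤ := fun h => hz <| inner_self_eq_zero.1 <|
    Submodule.mem_orthogonal_singleton_iff_inner_left.1 (h ▸ Submodule.mem_top : z ∈ (ℝ ∙ z)ᗮ)
  have hset : {w : E | ⟪w, z⟫ = 0} = ((ℝ ∙ z)ᗮ : Submodule ℝ E) :=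
    Set.ext fun w => Submodule.mem_orthogonal_singleton_iff_inner_left.symm
  rw [hset, stdGaussian_eq_withDensity]
  exact withDensity_absolutelyContinuous _ _ (Measure.addHaar_submodule volume _ hne)

end GaussianDensity

theorem solidAngle_eq_stdGaussian {d : ℕ} (hd : d ≠ 0) {K : Set (EuclideanSpace ℝ (Fin d))}
    (hK : MeasurableSet K) (hcone : ∀ c : ℝ, 0 < c → ∀ w, c • w ∈ K ↔ w ∈ K) :
    solidAngle K = (stdGaussian (EuclideanSpace ℝ (Fin d))).real K := by
  have : NeZero d := ⟨hd⟩
  have hmeas : Measurable fun ρ : ℝ => ENNReal.ofReal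
      ((√(2 * Real.pi))⁻¹ ^ Module.finrank ℝ (EuclideanSpace ℝ (Fin d)) *
        Real.exp (-ρ ^ 2 / 2)) := by
    fun_prop
  have polar {L : Set (EuclideanSpace ℝ (Fin d))} (hL : MeasurableSet L)
      (hcone : ∀ c : ℝ, 0 < c → ∀ w, c • w ∈ L ↔ w ∈ L) :=
    congrArg ENNReal.toReal <|
      (congrArg (· L) <| congrArg DFunLike.coe stdGaussian_eq_withDensity).trans <|
      (withDensity_apply _ hL).trans (setLIntegral_norm_eq_toSphere_mul volume hL hcone hmeas)
  have huniv := polar MeasurableSet.univ fun _ _ _ => Iff.rfl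
  have hKpolar := polar hK hcone
  simp only [Set.mem_univ, Set.ofPred_true, ENNReal.toReal_mul, measure_univ,
    ENNReal.toReal_one] at huniv hKpolar
  rw [solidAngle, measureReal_def, measureReal_def, measureReal_def, hKpolar,
    eq_one_div_of_mul_eq_one_right huniv.symm, mul_one_div]

section ExtremalDirections

variable {J E W : Type*} [NormedAddCommGroup E] [InnerProductSpace ℝ E]
  [NormedAddCommGroup W] [InnerProductSpace ℝ W]

/-- The directions `w` for which the functional `⟪w, ·⟫` attains at `x i` its maximum over the
family `x`. -/
def maximizingDirections (x : J → E) (i : J) : Set E :=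
  {w | ∀ j, ⟪w, x j⟫ ≤ ⟪w, x i⟫}

/-- The directions `w` for which the functional `⟪w, ·⟫` attains at `x i` its maximum or its minimum
over the family `x`. -/
def extremalDirections (x : J → E) (i : J) : Set E :=
  {w | (∀ j, ⟪w, x j⟫ ≤ ⟪w, x i⟫) ∨ ∀ j, ⟪w, x i⟫ ≤ ⟪w, x j⟫}

variable (x : J → E) (i : J)

theorem extremalDirections_eq_union :
    extremalDirections x i = maximizingDirections x i ∪ Neg.neg ⁻¹' maximizingDirections x i := by
  ext w
  simp only [extremalDirections, maximizingDirections, Set.mem_ofPred_eq, Set.mem_union,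
    Set.mem_preimage, inner_neg_left, neg_le_neg_iff]

theorem extremalDirections_sub_const (a : E) :
    extremalDirections (fun j => x j - a) i = extremalDirections x i := by
  simp only [extremalDirections, inner_sub_right, sub_le_sub_iff_right]

theorem preimage_adjoint_extremalDirections [FiniteDimensional ℝ E] [FiniteDimensional ℝ W]
    (L : E →ₗ[ℝ] W) :
    L.adjoint ⁻¹' extremalDirections x i = extremalDirections (L ∘ x) i := by
  simp only [extremalDirections, Set.preimage_ofPred_eq, LinearMap.adjoint_inner_left,
    Function.comp_apply]

theorem smul_mem_maximizingDirections_iff {c : ℝ} (hc : 0 < c) (w : E) :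
    c • w ∈ maximizingDirections x i ↔ w ∈ maximizingDirections x i := by
  simp only [maximizingDirections, Set.mem_ofPred_eq, real_inner_smul_left,
    mul_le_mul_iff_right₀ hc]

variable [MeasurableSpace E] [BorelSpace E] [FiniteDimensional ℝ E]

theorem stdGaussian_real_preimage_neg (K : Set E) :
    (stdGaussian E).real (Neg.neg ⁻¹' K) = (stdGaussian E).real K := by
  rw [← congrArg (fun μ : Measure E => μ.real K) (stdGaussian_map (LinearIsometryEquiv.neg ℝ))]
  exact congrArg ENNReal.toReal ((MeasurableEquiv.neg E).map_apply K).symm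

variable {x i} in
theorem stdGaussian_maximizingDirections_inter {j : J} (hij : x i ≠ x j) :
    stdGaussian E (maximizingDirections x i ∩ maximizingDirections x j) = 0 := by
  refine measure_mono_null ?_ (stdGaussian_orthogonal_eq_zero (sub_ne_zero.2 hij))
  rintro w ⟨hi, hj⟩
  exact (inner_sub_right w _ _).trans (sub_eq_zero.2 ((hj i).antisymm (hi j)))

variable [Countable J]

theorem measurableSet_maximizingDirections : MeasurableSet (maximizingDirections x i) := by
  simp only [maximizingDirections, Set.ofPred_forall]
  exact .iInter fun j => measurableSet_le (by fun_prop) (by fun_prop)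

theorem measurableSet_extremalDirections : MeasurableSet (extremalDirections x i) := by
  rw [extremalDirections_eq_union]
  exact (measurableSet_maximizingDirections x i).union
    ((measurableSet_maximizingDirections x i).preimage measurable_neg)

variable {x i}

theorem sum_stdGaussian_maximizingDirections_le_one {I : Finset J} (hI : Set.InjOn x I) :
    ∑ i ∈ I, (stdGaussian E).real (maximizingDirections x i) ≤ 1 := by
  rw [← measureReal_biUnion_finset₀ (fun i hi j hj hij =>
      stdGaussian_maximizingDirections_inter (hI.ne hi hj hij))
    fun i _ => (measurableSet_maximizingDirections x i).nullMeasurableSet]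
  exact measureReal_le_one

theorem stdGaussian_extremalDirections_eq_two_mul {j : J} (hij : x i ≠ x j) :
    (stdGaussian E).real (extremalDirections x i) =
      2 * (stdGaussian E).real (maximizingDirections x i) := by
  have hmeas := measurableSet_maximizingDirections x i
  have hdisj : AEDisjoint (stdGaussian E) (maximizingDirections x i)
      (Neg.neg ⁻¹' maximizingDirections x i) := by
    refine measure_mono_null ?_ (stdGaussian_orthogonal_eq_zero (sub_ne_zero.2 hij))
    rintro w ⟨hw, hneg⟩
    have hmin := hneg j
    rw [inner_neg_left, inner_neg_left, neg_le_neg_iff] at hmin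
    exact (inner_sub_right w _ _).trans (sub_eq_zero.2 (hmin.antisymm (hw j)))
  rw [extremalDirections_eq_union,
    measureReal_union₀ (hmeas.preimage measurable_neg).nullMeasurableSet hdisj,
    stdGaussian_real_preimage_neg, two_mul]

theorem stdGaussian_extremalDirections_map_ge [FiniteDimensional ℝ W] [MeasurableSpace W]
    [BorelSpace W] (L : E →ₗ[ℝ] W) (x : J → E) (i : J) :
    (stdGaussian E).real (extremalDirections x i) *
        (1 - 8 * √(isometryDefect (L ∘ₗ (vectorSpan ℝ (Set.range x)).subtype)) *
          (1 + Real.log (1 / (stdGaussian E).real (extremalDirections x i)))) ≤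
      (stdGaussian W).real (extremalDirections (L ∘ x) i) := by
  set V := vectorSpan ℝ (Set.range x)
  let z : J → V := fun j =>
    ⟨x j - x i, vsub_mem_vectorSpan ℝ (Set.mem_range_self j) (Set.mem_range_self i)⟩
  have hz : V.subtype ∘ z = fun j => x j - x i := rfl
  have hLz : (L ∘ₗ V.subtype) ∘ z = fun j => (L ∘ x) j - L (x i) :=
    funext fun j => map_sub L (x j) (x i)
  have hprojection : (stdGaussian E).map V.subtype.adjoint = stdGaussian V := by
    have hnorm : ∀ t, ‖V.subtype.adjoint.adjoint t‖ = ‖(LinearMap.id : V →ₗ[ℝ] V).adjoint t‖ :=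
      fun t => by rw [LinearMap.adjoint_adjoint, LinearMap.adjoint_id]; rfl
    rw [stdGaussian_map_eq_of_norm_adjoint_eq hnorm]
    exact Measure.map_id
  have hV : (stdGaussian V).real (extremalDirections z i) =
      (stdGaussian E).real (extremalDirections x i) := by
    rw [← hprojection, map_measureReal_apply (by fun_prop) (measurableSet_extremalDirections z i),
      preimage_adjoint_extremalDirections, hz, extremalDirections_sub_const]
  have := stdGaussian_preimage_adjoint_ge (L ∘ₗ V.subtype) (measurableSet_extremalDirections z i)
  rwa [hV, preimage_adjoint_extremalDirections, hLz, extremalDirections_sub_const] at this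

end ExtremalDirections

section ExtremePoints

variable {E : Type*} [NormedAddCommGroup E] [InnerProductSpace ℝ E]

theorem not_collinear_of_mem_extremePoints {A : Set E} {a b c : E} (ha : a ∈ A.extremePoints ℝ)
    (hb : b ∈ A.extremePoints ℝ) (hc : c ∈ A.extremePoints ℝ) (hab : a ≠ b) (hac : a ≠ c)
    (hbc : b ≠ c) : ¬Collinear ℝ {a, b, c} := by
  have hmid : ∀ {x y z : E}, x ∈ A.extremePoints ℝ → y ∈ A.extremePoints ℝ →
      z ∈ A.extremePoints ℝ → x ≠ y → y ≠ z → ¬Wbtw ℝ x y z := fun hx hy hz hxy hyz hwbtw =>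
    (mem_extremePoints_iff_forall_segment.1 hy).2 _ hx.1 _ hz.1 hwbtw.mem_segment |>.elim hxy
      hyz.symm
  intro hcol
  rcases hcol.wbtw_or_wbtw_or_wbtw with h | h | h
  exacts [hmid ha hb hc hab hbc h, hmid hb hc ha hbc hac.symm h, hmid hc ha hb hac.symm hab h]

variable {J : Type*} [Finite J] {x : J → E} {i : J}

theorem exists_inner_lt_of_mem_extremePoints [CompleteSpace E]
    (hi : x i ∈ (convexHull ℝ (Set.range x)).extremePoints ℝ) :
    ∃ w : E, ∀ j, x j ≠ x i → ⟪w, x j⟫ < ⟪w, x i⟫ := by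
  have hnotMem : x i ∉ convexHull ℝ (Set.range x \ {x i}) := fun h =>
    ((convex_convexHull ℝ _).mem_extremePoints_iff_mem_sdiff_convexHull_sdiff.1 hi).2
      (convexHull_mono (Set.sdiff_subset_sdiff_left (subset_convexHull ℝ _)) h)
  have hfinite : (Set.range x \ {x i}).Finite := (Set.finite_range x).subset Set.sdiff_subset
  obtain ⟨f, u, hfu, hux⟩ := geometric_hahn_banach_closed_point (convex_convexHull ℝ _)
    (hfinite.isCompact_convexHull ℝ).isClosed hnotMem
  refine ⟨(InnerProductSpace.toDual ℝ E).symm f, fun j hj => ?_⟩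
  simp only [InnerProductSpace.toDual_symm_apply]
  exact (hfu _ (subset_convexHull ℝ _ ⟨⟨j, rfl⟩, hj⟩)).trans hux

theorem stdGaussian_maximizingDirections_pos [FiniteDimensional ℝ E] [MeasurableSpace E]
    [BorelSpace E] (hi : x i ∈ (convexHull ℝ (Set.range x)).extremePoints ℝ) :
    0 < (stdGaussian E).real (maximizingDirections x i) := by
  obtain ⟨w, hw⟩ := exists_inner_lt_of_mem_extremePoints hi
  have hopen : IsOpen {w : E | ∀ j, x j ≠ x i → ⟪w, x j⟫ < ⟪w, x i⟫} := by
    simp only [Set.ofPred_forall]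
    exact isOpen_iInter_of_finite fun j => isOpen_iInter_of_finite fun _ =>
      isOpen_lt (by fun_prop) (by fun_prop)
  refine (ENNReal.toReal_pos (hopen.measure_pos (stdGaussian E) ⟨w, hw⟩).ne'
    (measure_ne_top _ _)).trans_le (measureReal_mono (fun v hv j => ?_) (measure_ne_top _ _))
  rcases eq_or_ne (x j) (x i) with h | h
  exacts [(congrArg _ h).le, (hv j h).le]

theorem inner_le_of_extremePoints_subset {I : Set J}
    (hI : (convexHull ℝ (Set.range x)).extremePoints ℝ ⊆ x '' I) {w : E} {c : ℝ}
    (hw : ∀ i ∈ I, ⟪w, x i⟫ ≤ c) (j : J) : ⟪w, x j⟫ ≤ c := by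
  have hconvex : Convex ℝ {y | ⟪w, y⟫ ≤ c} := convex_halfSpace_le (innerₛₗ ℝ w).isLinear c
  have hclosed : IsClosed {y | ⟪w, y⟫ ≤ c} := isClosed_le (by fun_prop) continuous_const
  have himage : x '' I ⊆ {y | ⟪w, y⟫ ≤ c} := Set.image_subset_iff.2 hw
  have hmem : x j ∈ closure (convexHull ℝ ((convexHull ℝ (Set.range x)).extremePoints ℝ)) := by
    rw [closure_convexHull_extremePoints ((Set.finite_range x).isCompact_convexHull ℝ)
      (convex_convexHull ℝ _)]
    exact subset_convexHull ℝ _ ⟨j, rfl⟩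
  exact closure_minimal (convexHull_min (hI.trans himage) hconvex) hclosed hmem

theorem extremalDirections_eq_univ {I : Finset J}
    (hI : (convexHull ℝ (Set.range x)).extremePoints ℝ ⊆ x '' I) (hcard : I.card ≤ 2)
    (hi : i ∈ I) : extremalDirections x i = Set.univ := by
  classical
  have := Nonempty.intro i
  obtain ⟨k, hk⟩ := Finset.card_le_one_iff_subset_singleton.1 <|
    (Finset.card_erase_of_mem hi).le.trans (Nat.sub_le_of_le_add hcard)
  have hI' : ∀ j ∈ I, j = i ∨ j = k := fun j hj => or_iff_not_imp_left.2 fun hne =>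
    Finset.mem_singleton.1 (hk (Finset.mem_erase.2 ⟨hne, hj⟩))
  refine Set.eq_univ_of_forall fun w => ?_
  rcases le_total ⟪w, x k⟫ ⟪w, x i⟫ with h | h
  · refine Or.inl (inner_le_of_extremePoints_subset hI fun j hj => ?_)
    rcases hI' j hj with rfl | rfl
    exacts [le_rfl, h]
  · refine Or.inr fun j => neg_le_neg_iff.1 ?_
    simp only [← inner_neg_left]
    refine inner_le_of_extremePoints_subset hI (fun j hj => ?_) j
    simp only [inner_neg_left, neg_le_neg_iff]
    rcases hI' j hj with rfl | rfl
    exacts [le_rfl, h]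

end ExtremePoints

section CountSketch

variable {B d : ℕ}

/-- The CountSketch matrix with positions and signs `s`. -/
def sketchMatrix (s : Fin d → Fin B × Bool) : Matrix (Fin B) (Fin d) ℝ :=
  Matrix.of fun b j => if (s j).1 = b then (if (s j).2 then 1 else -1) else 0

/-- The CountSketch matrix with positions and signs `s` as a linear map of Euclidean spaces. -/
noncomputable def sketchMap (s : Fin d → Fin B × Bool) :
    EuclideanSpace ℝ (Fin d) →ₗ[ℝ] EuclideanSpace ℝ (Fin B) :=
  (sketchMatrix s).toEuclideanLin

theorem sketchMatrix_cons_mulVec (p : Fin B × Bool) (s : Fin d → Fin B × Bool)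
    (x : Fin (d + 1) → ℝ) :
    sketchMatrix (Fin.cons p s : Fin (d + 1) → Fin B × Bool) *ᵥ x =
      Pi.single p.1 ((if p.2 then 1 else -1) * x 0) + sketchMatrix s *ᵥ Fin.tail x := by
  ext b
  simp only [Matrix.mulVec, dotProduct, sketchMatrix, Matrix.of_apply, Fin.sum_univ_succ,
    Fin.cons_zero, Fin.cons_succ, Pi.add_apply, Pi.single_apply, Fin.tail, eq_comm (a := b),
    ite_mul, zero_mul]

theorem sketchMatrix_cons_dotProduct (p : Fin B × Bool) (s : Fin d → Fin B × Bool)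
    (x y : Fin (d + 1) → ℝ) :
    (sketchMatrix (Fin.cons p s : Fin (d + 1) → Fin B × Bool) *ᵥ x) ⬝ᵥ
        (sketchMatrix (Fin.cons p s : Fin (d + 1) → Fin B × Bool) *ᵥ y) =
      (x 0 * y 0 + (sketchMatrix s *ᵥ Fin.tail x) ⬝ᵥ (sketchMatrix s *ᵥ Fin.tail y)) +
        (if p.2 then 1 else -1) *
          (sketchMatrix s *ᵥ (x 0 • Fin.tail y + y 0 • Fin.tail x)) p.1 := by
  have hsign : ((if p.2 then 1 else -1) * (if p.2 then 1 else -1) : ℝ) = 1 := by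
    split_ifs <;> norm_num
  simp only [sketchMatrix_cons_mulVec, add_dotProduct, dotProduct_add, single_dotProduct,
    dotProduct_single, Matrix.mulVec_add, Matrix.mulVec_smul, Pi.add_apply, Pi.smul_apply,
    smul_eq_mul, Pi.single_eq_same]
  linear_combination x 0 * y 0 * hsign

theorem dotProduct_fin_succ (x y : Fin (d + 1) → ℝ) :
    x ⬝ᵥ y = x 0 * y 0 + Fin.tail x ⬝ᵥ Fin.tail y :=
  Fin.sum_univ_succ _

theorem expect_fin_succ {α : Type*} [Fintype α] (F : (Fin (d + 1) → α) → ℝ) :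
    𝔼 s, F s = 𝔼 s : Fin d → α, 𝔼 p : α, F (Fin.cons p s) := by
  rw [Finset.expect_comm, ← Finset.expect_product', Finset.univ_product_univ]
  exact (Fintype.expect_equiv (Fin.consEquiv fun _ => α) _ _ fun _ => rfl).symm

theorem expect_sign_mul {κ : Type*} [Fintype κ] (f : κ → ℝ) :
    𝔼 p : κ × Bool, (if p.2 then 1 else -1) * f p.1 = 0 := by
  rw [Fintype.expect_eq_sum_div_card, Fintype.sum_prod_type]
  simp only [Fintype.sum_bool, if_true, Bool.false_eq_true, if_false, one_mul, neg_mul,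
    add_neg_cancel, Finset.sum_const_zero, zero_div]

theorem expect_add_sign_mul_sq {κ : Type*} [Fintype κ] [Nonempty κ] (a : ℝ) (f : κ → ℝ) :
    𝔼 p : κ × Bool, (a + (if p.2 then 1 else -1) * f p.1) ^ 2 =
      a ^ 2 + f ⬝ᵥ f / Fintype.card κ := by
  have hexpand : ∀ p : κ × Bool, (a + (if p.2 then 1 else -1) * f p.1) ^ 2 =
      a ^ 2 + (if p.2 then 1 else -1) * (2 * a * f p.1) + f p.1 * f p.1 := fun p => by
    split_ifs <;> ring
  have hsq : 𝔼 p : κ × Bool, f p.1 * f p.1 = f ⬝ᵥ f / Fintype.card κ := by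
    rw [← Finset.univ_product_univ, Finset.expect_product]
    simp only [Finset.expect_const Finset.univ_nonempty, Fintype.expect_eq_sum_div_card, dotProduct]
  simp only [hexpand, Finset.expect_add_distrib, Fintype.expect_const,
    expect_sign_mul fun k => 2 * a * f k, hsq, add_zero]

variable [NeZero B]

theorem expect_sketchMatrix_mulVec_dotProduct_self (x : Fin d → ℝ) :
    𝔼 s : Fin d → Fin B × Bool, (sketchMatrix s *ᵥ x) ⬝ᵥ (sketchMatrix s *ᵥ x) = x ⬝ᵥ x := by
  induction d with
  | zero => simp only [Subsingleton.elim x 0, Matrix.mulVec_zero, dotProduct_zero,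
      Finset.expect_const_zero]
  | succ d ih =>
    rw [expect_fin_succ]
    simp only [sketchMatrix_cons_dotProduct, Finset.expect_add_distrib, Fintype.expect_const,
      expect_sign_mul, add_zero, ih, dotProduct_fin_succ x]

theorem expect_sketchMatrix_dotProduct_sub_sq_le (x y : Fin d → ℝ) :
    𝔼 s : Fin d → Fin B × Bool,
        ((sketchMatrix s *ᵥ x) ⬝ᵥ (sketchMatrix s *ᵥ y) - x ⬝ᵥ y) ^ 2 ≤
      2 / B * (x ⬝ᵥ x) * (y ⬝ᵥ y) := by
  induction d with
  | zero => simp only [Subsingleton.elim x 0, Matrix.mulVec_zero, zero_dotProduct, sub_zero,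
      zero_pow two_ne_zero, Finset.expect_const_zero, mul_zero, zero_mul, le_refl]
  | succ d ih =>
    set x' := Fin.tail x
    set y' := Fin.tail y
    set z := x 0 • y' + y 0 • x'
    have hz : z ⬝ᵥ z ≤ 2 * (x 0 ^ 2 * (y' ⬝ᵥ y') + y 0 ^ 2 * (x' ⬝ᵥ x')) := by
      have : 0 ≤ (x 0 • y' - y 0 • x') ⬝ᵥ (x 0 • y' - y 0 • x') :=
        Finset.sum_nonneg fun _ _ => mul_self_nonneg _
      simp only [z, sub_dotProduct, dotProduct_sub, add_dotProduct, dotProduct_add, smul_dotProduct,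
        dotProduct_smul, smul_eq_mul] at this ⊢
      linarith
    have herror : ∀ (s : Fin d → Fin B × Bool) (p : Fin B × Bool),
        (sketchMatrix (Fin.cons p s : Fin (d + 1) → Fin B × Bool) *ᵥ x) ⬝ᵥ
            (sketchMatrix (Fin.cons p s : Fin (d + 1) → Fin B × Bool) *ᵥ y) - x ⬝ᵥ y =
          ((sketchMatrix s *ᵥ x') ⬝ᵥ (sketchMatrix s *ᵥ y') - x' ⬝ᵥ y') +
            (if p.2 then 1 else -1) * (sketchMatrix s *ᵥ z) p.1 := fun s p => by
      rw [sketchMatrix_cons_dotProduct, dotProduct_fin_succ x y]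
      ring
    calc _ = 𝔼 s : Fin d → Fin B × Bool,
            ((sketchMatrix s *ᵥ x') ⬝ᵥ (sketchMatrix s *ᵥ y') - x' ⬝ᵥ y') ^ 2 + z ⬝ᵥ z / B := by
          rw [expect_fin_succ]
          simp only [herror, expect_add_sign_mul_sq, Finset.expect_add_distrib, ← Finset.expect_div,
            expect_sketchMatrix_mulVec_dotProduct_self, Fintype.card_fin]
      _ ≤ 2 / B * (x' ⬝ᵥ x') * (y' ⬝ᵥ y') +
            2 * (x 0 ^ 2 * (y' ⬝ᵥ y') + y 0 ^ 2 * (x' ⬝ᵥ x')) / B := by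
          gcongr
          exact ih x' y'
      _ ≤ 2 / B * (x ⬝ᵥ x) * (y ⬝ᵥ y) := by
          have : 0 ≤ 2 / (B : ℝ) * (x 0 ^ 2 * y 0 ^ 2) := by positivity
          rw [dotProduct_fin_succ x, dotProduct_fin_succ y]
          linear_combination this

theorem expect_isometryDefect_sketchMap_le (V : Submodule ℝ (EuclideanSpace ℝ (Fin d))) :
    𝔼 s : Fin d → Fin B × Bool, isometryDefect (sketchMap s ∘ₗ V.subtype) ≤
      2 / B * (Module.finrank ℝ V) ^ 2 := by
  let b := stdOrthonormalBasis ℝ V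
  have hpair : ∀ i j, 𝔼 s : Fin d → Fin B × Bool,
      (⟪sketchMap s (b i), sketchMap s (b j)⟫ - ⟪b i, b j⟫) ^ 2 ≤ 2 / (B : ℝ) := fun i j => by
    have hself : ∀ i, (b i).1.ofLp ⬝ᵥ (b i).1.ofLp = 1 := fun i =>
      inner_self_eq_one_of_norm_eq_one (b.norm_eq_one i)
    have := expect_sketchMatrix_dotProduct_sub_sq_le (B := B) (b j).1.ofLp (b i).1.ofLp
    rwa [hself, hself, mul_one, mul_one] at this
  simp only [isometryDefect_eq_sum_inner_sub_inner_sq _ b, Finset.expect_sum_comm]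
  refine (Finset.sum_le_sum fun i _ => Finset.sum_le_sum fun j _ => hpair i j).trans_eq ?_
  simp only [Finset.sum_const, Finset.card_univ, Fintype.card_fin, nsmul_eq_mul]
  ring

end CountSketch

section ErrorEstimates

theorem log_one_div_one_sub_le_three_mul {q : ℝ} (hq : 0 ≤ q) (hq1 : q ≤ 2 / 3) :
    Real.log (1 / (1 - q)) ≤ 3 * q := by
  have hq' : 0 < 1 - q := by linarith
  calc Real.log (1 / (1 - q)) ≤ 1 / (1 - q) - 1 := Real.log_le_sub_one_of_pos (by positivity)
    _ ≤ 3 * q := by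
      rw [sub_le_iff_le_add, div_le_iff₀ hq']
      nlinarith

theorem le_log_one_div_one_sub {q : ℝ} (hq1 : q < 1) : q ≤ Real.log (1 / (1 - q)) := by
  rw [one_div, Real.log_inv]
  linarith [Real.log_le_sub_one_of_pos (sub_pos.2 hq1)]

theorem one_sub_le_exp_neg_log_mul {p q t : ℝ} (hq : 0 ≤ q) (hq1 : q ≤ 2 / 3) (ht : 0 ≤ t)
    (hp : q * (1 - t) ≤ p) :
    1 - p ≤ Real.exp (-(Real.log (1 / (1 - q)) * (1 - 3 * t))) := by
  set l := Real.log (1 / (1 - q)) with hl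
  have hexp : 1 - q = Real.exp (-l) := by
    rw [hl, one_div, Real.log_inv, neg_neg, Real.exp_log (by linarith)]
  have hql : q ≤ l := le_log_one_div_one_sub (by linarith)
  calc 1 - p ≤ (1 - q) * (1 + 3 * q * t) := by
        nlinarith [mul_nonneg hq ht, mul_nonneg (mul_nonneg hq ht) (by linarith : 0 ≤ 2 - 3 * q)]
    _ ≤ Real.exp (-l) * Real.exp (3 * t * l) := by
        rw [hexp]
        gcongr
        nlinarith [Real.add_one_le_exp (3 * t * l)]
    _ = Real.exp (-(l * (1 - 3 * t))) := by
        rw [← Real.exp_add]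
        ring_nf

theorem one_sub_pow_le_exp {p q t L : ℝ} {m : ℕ} (hq : 0 ≤ q) (hq1 : q ≤ 2 / 3)
    (ht : 0 ≤ t) (hp0 : 0 ≤ p) (hp1 : p ≤ 1) (hp : q * (1 - t) ≤ p) (hL : 0 ≤ L)
    (hm : L ≤ m * Real.log (1 / (1 - q))) :
    (1 - p) ^ m ≤ Real.exp (-L) * Real.exp (3 * t * L) := by
  rw [← Real.exp_add]
  rcases le_or_gt 1 (3 * t) with ht1 | ht1
  · calc (1 - p) ^ m ≤ 1 := pow_le_one₀ (by linarith) (by linarith)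
      _ ≤ Real.exp (-L + 3 * t * L) := Real.one_le_exp (by nlinarith)
  · calc (1 - p) ^ m ≤ Real.exp (-(Real.log (1 / (1 - q)) * (1 - 3 * t))) ^ m :=
          pow_le_pow_left₀ (by linarith) (one_sub_le_exp_neg_log_mul hq hq1 ht hp) m
      _ = Real.exp (-(m * Real.log (1 / (1 - q)) * (1 - 3 * t))) := by
          rw [← Real.exp_nat_mul]
          ring_nf
      _ ≤ Real.exp (-L + 3 * t * L) := Real.exp_le_exp.2 (by nlinarith)

theorem exp_neg_half_le_eight_div_sq {l : ℝ} (hl : 0 < l) : Real.exp (-(l / 2)) ≤ 8 / l ^ 2 := by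
  rw [Real.exp_neg, inv_le_comm₀ (Real.exp_pos _) (by positivity), inv_div]
  linarith [Real.quadratic_le_exp_of_nonneg (half_pos hl).le]

theorem le_add_sq_of_le_mul_exp {A δ y : ℝ} (hδ : 0 < δ) (hδ1 : δ < 1) (hy : 0 ≤ y)
    (hA : A ≤ 1) (hAexp : A ≤ δ * Real.exp y) :
    A ≤ 3 / 2 * δ + 72 * y ^ 2 / Real.log (1 / δ) ^ 2 := by
  set l := Real.log (1 / δ) with hl
  have hl0 : 0 < l := Real.log_pos (by rwa [one_lt_div hδ])
  rcases le_or_gt y (1 / 3) with hy3 | hy3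
  · have hexp : Real.exp y ≤ 3 / 2 := by
      refine (Real.exp_le_exp.2 hy3).trans ?_
      refine (Real.exp_bound_div_one_sub_of_interval (by norm_num) (by norm_num)).trans ?_
      norm_num
    calc A ≤ δ * (3 / 2) := hAexp.trans (by gcongr)
      _ ≤ 3 / 2 * δ + 72 * y ^ 2 / l ^ 2 := by
        rw [mul_comm]
        exact le_add_of_nonneg_right (by positivity)
  suffices hmain : A ≤ 72 * y ^ 2 / l ^ 2 by linarith
  rcases le_or_gt (l / 2) y with hly | hly
  · refine hA.trans ?_
    rw [le_div_iff₀ (by positivity)]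
    nlinarith
  · calc A ≤ Real.exp (-l) * Real.exp y := by
          rwa [hl, one_div, Real.log_inv, neg_neg, Real.exp_log hδ]
      _ ≤ Real.exp (-(l / 2)) := by
          rw [← Real.exp_add]
          exact Real.exp_le_exp.2 (by linarith)
      _ ≤ 8 / l ^ 2 := exp_neg_half_le_eight_div_sq hl0
      _ ≤ 72 * y ^ 2 / l ^ 2 := by
          gcongr
          nlinarith

theorem le_six_mul_of_log_le {k m q δ : ℝ} (hk : 3 ≤ k) (hm0 : 0 ≤ m) (hδ : 0 < δ)
    (hδ1 : δ ≤ 1 / 2) (hq : 0 < q) (hqk : q ≤ 2 / k)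
    (hm : Real.log (k / δ) ≤ m * Real.log (1 / (1 - q))) : 1 / q ≤ 6 * m ∧ k ≤ 6 * m := by
  have hq1 : q ≤ 2 / 3 := hqk.trans (by gcongr)
  have hL : 1 ≤ Real.log (k / δ) := by
    rw [Real.le_log_iff_exp_le (by positivity), le_div_iff₀ hδ]
    nlinarith [Real.exp_one_lt_d9]
  have hqm : 1 ≤ 3 * m * q := by
    nlinarith [mul_le_mul_of_nonneg_left (log_one_div_one_sub_le_three_mul hq.le hq1) hm0]
  have hqm' : 1 / q ≤ 3 * m := by rwa [div_le_iff₀ hq]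
  have hkq : k ≤ 2 * (1 / q) := by
    rw [le_div_iff₀ (by linarith)] at hqk
    rw [mul_one_div, le_div_iff₀ hq]
    linarith
  constructor <;> linarith

theorem log_six_mul_le {m : ℝ} (hm : 0 < m) : Real.log (6 * m) ≤ 2 + Real.log m := by
  have hlog_six : Real.log 6 ≤ 2 := by
    rw [Real.log_le_iff_le_exp (by norm_num), show (2 : ℝ) = 1 + 1 by norm_num, Real.exp_add]
    nlinarith [Real.exp_one_gt_d9]
  rw [Real.log_mul (by norm_num) hm.ne']
  linarith

theorem sq_mul_log_le {k m q δ : ℝ} (hk : 3 ≤ k) (hm1 : 1 ≤ m) (hδ : 0 < δ) (hδ1 : δ ≤ 1 / 2)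
    (hq : 0 < q) (hqk : q ≤ 2 / k) (hm : Real.log (k / δ) ≤ m * Real.log (1 / (1 - q))) :
    ((1 + Real.log (1 / q)) * Real.log (k / δ)) ^ 2 ≤
      625 * (1 + Real.log m) ^ 4 * Real.log (1 / δ) ^ 2 := by
  obtain ⟨hqm, hkm⟩ := le_six_mul_of_log_le hk (by linarith) hδ hδ1 hq hqk hm
  have hk0 : 0 < k := by linarith
  have hq1 : q ≤ 1 := (hqk.trans (show 2 / k ≤ 2 / 3 by gcongr)).trans (by norm_num)
  have hlog_m : 0 ≤ Real.log m := Real.log_nonneg hm1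
  have hlog_k : 0 ≤ Real.log k := Real.log_nonneg (by linarith)
  have hlog_q : 0 ≤ Real.log (1 / q) := Real.log_nonneg (by rwa [one_le_div hq])
  have hlog_δ : 1 / 2 ≤ Real.log (1 / δ) := by
    have : Real.log 2 ≤ Real.log (1 / δ) :=
      Real.log_le_log (by norm_num) (by rw [le_div_iff₀ hδ]; linarith)
    linarith [Real.log_two_gt_d9]
  have hlog_q_le : Real.log (1 / q) ≤ 2 + Real.log m :=
    (Real.log_le_log (by positivity) hqm).trans (log_six_mul_le (by linarith))
  have hlog_k_le : Real.log k ≤ 2 + Real.log m :=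
    (Real.log_le_log hk0 hkm).trans (log_six_mul_le (by linarith))
  have hL : Real.log (k / δ) = Real.log k + Real.log (1 / δ) := by
    rw [div_eq_mul_one_div, Real.log_mul hk0.ne' (by positivity)]
  calc ((1 + Real.log (1 / q)) * Real.log (k / δ)) ^ 2
      ≤ (5 * (1 + Real.log m) * (5 * (1 + Real.log m) * Real.log (1 / δ))) ^ 2 := by
        rw [hL]
        gcongr
        · linarith
        · nlinarith
    _ = 625 * (1 + Real.log m) ^ 4 * Real.log (1 / δ) ^ 2 := by ring

theorem one_add_log_pow_four_le {x : ℝ} (hx : 1 ≤ x) :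
    (1 + Real.log x) ^ 4 ≤ 9 ^ 4 * x ^ (1 / 2 : ℝ) := by
  have hlog_nonneg : 0 ≤ Real.log x := Real.log_nonneg hx
  have hlog : 1 + Real.log x ≤ 9 * x ^ (1 / 8 : ℝ) := by
    have hlog_le := Real.log_le_rpow_div (zero_le_one.trans hx) (show (0 : ℝ) < 1 / 8 by norm_num)
    have hone_le : 1 ≤ x ^ (1 / 8 : ℝ) := Real.one_le_rpow hx (by norm_num)
    linarith
  calc (1 + Real.log x) ^ 4 ≤ (9 * x ^ (1 / 8 : ℝ)) ^ 4 := by gcongr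
    _ = 9 ^ 4 * x ^ (1 / 2 : ℝ) := by
      rw [mul_pow, ← Real.rpow_natCast (x ^ (1 / 8 : ℝ)), ← Real.rpow_mul (by linarith)]
      norm_num

end ErrorEstimates

section SampleLaw

variable {α β : Type*} [MeasurableSpace α] [MeasurableSpace β]
  [MeasurableSingletonClass β]

theorem uniformOn_univ_prod_uniformOn_univ [Finite α] [MeasurableSingletonClass α] [Finite β] :
    (uniformOn (Set.univ : Set α)).prod (uniformOn (Set.univ : Set β)) =
      uniformOn (Set.univ : Set (α × β)) := by
  cases nonempty_fintype α
  cases nonempty_fintype β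
  refine Measure.prod_eq fun s t _ _ => ?_
  rw [uniformOn_univ, uniformOn_univ, uniformOn_univ, Measure.count_apply (.of_discrete),
    Measure.count_apply (.of_discrete), Measure.count_apply (.of_discrete), Set.encard_prod,
    Fintype.card_prod, Nat.cast_mul, ENat.toENNReal_mul,
    ENNReal.mul_div_mul_comm (.inr (by simp)) (.inl (by simp))]

theorem prod_uniformOn_univ_real_apply [Fintype β] (μ : Measure α) [IsFiniteMeasure μ]
    {A : Set (α × β)} (hA : MeasurableSet A) :
    (μ.prod (uniformOn (Set.univ : Set β))).real A = 𝔼 y, μ.real {x | (x, y) ∈ A} := by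
  have hsingleton : ∀ y : β, uniformOn (Set.univ : Set β) {y} = (Fintype.card β : ℝ≥0∞)⁻¹ :=
    fun y => by rw [uniformOn_univ, Measure.count_singleton, one_div]
  rw [measureReal_def, Measure.prod_apply_symm hA, lintegral_fintype]
  simp only [hsingleton]
  rw [← Finset.sum_mul, ENNReal.toReal_mul, ENNReal.toReal_sum fun y _ => measure_ne_top _ _,
    ENNReal.toReal_inv, ENNReal.toReal_natCast, Fintype.expect_eq_sum_div_card, div_eq_mul_inv]
  rfl

end SampleLaw

section Algorithm

variable {d n m B : ℕ} {X : Matrix (Fin d) (Fin n) ℝ} {I : Finset (Fin n)}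

theorem transform_mul_apply (ω : Sample m B d) (r : Fin m) (j : Fin n) :
    (transform ω * X) r j = ⟪WithLp.toLp 2 (ω.1 r), sketchMap ω.2 (column X j)⟫ := by
  rw [transform, Matrix.mul_assoc, Matrix.mul_apply, PiLp.inner_apply]
  exact Finset.sum_congr rfl fun b _ => mul_comm _ _

theorem mem_algorithmOutput_iff (ω : Sample m B d) (i : Fin n) :
    i ∈ algorithmOutput X ω ↔
      ∃ r, WithLp.toLp 2 (ω.1 r) ∈ extremalDirections (sketchMap ω.2 ∘ column X) i := by
  simp only [algorithmOutput, argmaxIndices, argminIndices, transform_mul_apply, Set.mem_union,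
    Set.mem_ofPred_eq, extremalDirections, Function.comp_apply, exists_or]

theorem measurableSet_subset_algorithmOutput :
    MeasurableSet {ω : Sample m B d | (I : Set (Fin n)) ⊆ algorithmOutput X ω} := by
  simp only [Set.subset_def, mem_algorithmOutput_iff]
  have hrow : ∀ r, Measurable fun G : Fin m → Fin B → ℝ =>
      (WithLp.toLp 2 (G r) : EuclideanSpace ℝ (Fin B)) := fun r => by fun_prop
  refine measurableSet_setOfPred.2 (measurable_from_prod_countable_left fun s => ?_)
  refine Measurable.forall fun i => Measurable.imp measurable_const (Measurable.exists fun r => ?_)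
  exact ((measurableSet_extremalDirections (sketchMap s ∘ column X) i).preimage (hrow r)).mem

/-- The probability, over the Gaussian matrix, that the algorithm misses one of the columns in `I`
when the CountSketch matrix has positions and signs `s`. -/
noncomputable def conditionalFailure (m : ℕ) (X : Matrix (Fin d) (Fin n) ℝ) (I : Finset (Fin n))
    (s : Fin d → Fin B × Bool) : ℝ :=
  (Measure.pi fun _ : Fin m => Measure.pi fun _ : Fin B => gaussianReal 0 1).real
    {G | ¬(I : Set (Fin n)) ⊆ algorithmOutput X ((G, s) : Sample m B d)}

theorem sampleLaw_real_compl_eq_expect [NeZero B] :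
    (sampleLaw m B d).real {ω | (I : Set (Fin n)) ⊆ algorithmOutput X ω}ᶜ =
      𝔼 s : Fin d → Fin B × Bool, conditionalFailure m X I s := by
  rw [sampleLaw, uniformOn_univ_prod_uniformOn_univ, ← uniformOn_pi, Set.pi_univ,
    prod_uniformOn_univ_real_apply _ measurableSet_subset_algorithmOutput.compl]
  rfl

theorem conditionalFailure_le_sum (s : Fin d → Fin B × Bool) :
    conditionalFailure m X I s ≤ ∑ i ∈ I, (1 - (stdGaussian (EuclideanSpace ℝ (Fin B))).real
      (extremalDirections (sketchMap s ∘ column X) i)) ^ m := by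
  set K := extremalDirections (sketchMap s ∘ column X)
  have hsubset : {G : Fin m → Fin B → ℝ |
      ¬(I : Set (Fin n)) ⊆ algorithmOutput X ((G, s) : Sample m B d)} ⊆
        ⋃ i ∈ I, Set.univ.pi fun _ => WithLp.toLp 2 ⁻¹' (K i)ᶜ := fun G hG => by
    obtain ⟨i, hi, hGi⟩ := Set.not_subset.1 hG
    rw [mem_algorithmOutput_iff, not_exists] at hGi
    exact Set.mem_biUnion hi fun r _ => hGi r
  refine (measureReal_mono hsubset (measure_ne_top _ _)).trans <|
    (measureReal_biUnion_finset_le _ _).trans_eq <| Finset.sum_congr rfl fun i _ => ?_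
  have hK : MeasurableSet (K i) := measurableSet_extremalDirections _ i
  rw [measureReal_def, Measure.pi_pi, Finset.prod_const, Finset.card_univ, Fintype.card_fin,
    ENNReal.toReal_pow, ← Measure.map_apply (by fun_prop) hK.compl, map_pi_eq_stdGaussian,
    ← measureReal_def, probReal_compl_eq_one_sub hK]

end Algorithm

section ExtremeIndexSet

variable {d n m B : ℕ} {X : Matrix (Fin d) (Fin n) ℝ} {I : Finset (Fin n)}

theorem subset_algorithmOutput_of_card_le_two (hI : IsExtremeIndexSet X I) (hcard : I.card ≤ 2)
    (hm : 1 ≤ m) (ω : Sample m B d) : (I : Set (Fin n)) ⊆ algorithmOutput X ω := fun i hi => by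
  refine (mem_algorithmOutput_iff ω i).2 ⟨⟨0, hm⟩, ?_⟩
  rw [← preimage_adjoint_extremalDirections, extremalDirections_eq_univ hI.image_eq.ge hcard hi]
  exact Set.mem_univ _

theorem IsExtremeIndexSet.two_le_dim (hI : IsExtremeIndexSet X I) (hcard : 3 ≤ I.card) :
    2 ≤ d := by
  obtain ⟨a, ha, b, hb, c, hc, hab, hac, hbc⟩ := Finset.two_lt_card.1 hcard
  have hcol := not_collinear_of_mem_extremePoints (hI.mapsTo ha) (hI.mapsTo hb) (hI.mapsTo hc)
    (hI.injOn.ne ha hb hab) (hI.injOn.ne ha hc hac) (hI.injOn.ne hb hc hbc)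
  rw [collinear_iff_finrank_le_one, not_le] at hcol
  exact hcol.trans_le ((Submodule.finrank_le _).trans_eq finrank_euclideanSpace_fin)

theorem normalCone_polytope_column (X : Matrix (Fin d) (Fin n) ℝ) (i : Fin n) :
    normalCone (polytope X) (column X i) = maximizingDirections (column X) i := by
  ext w
  simp only [normalCone, maximizingDirections, inner_sub_right, sub_nonpos, Set.mem_ofPred_eq]
  refine ⟨fun hw j => hw _ (subset_convexHull ℝ _ ⟨j, rfl⟩), fun hw y hy => ?_⟩
  exact convexHull_min (t := {y | ⟪w, y⟫ ≤ ⟪w, column X i⟫}) (Set.range_subset_iff.2 hw)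
    (convex_halfSpace_le (innerₛₗ ℝ w).isLinear _) hy

theorem IsExtremeIndexSet.exists_conditionNumber_eq (hI : IsExtremeIndexSet X I)
    (hcard : 3 ≤ I.card) :
    ∃ q : ℝ, 0 < q ∧ q ≤ 2 / I.card ∧
      conditionNumber X I * I.card = 1 / Real.log (1 / (1 - q)) ∧
      ∀ i ∈ I, q ≤ (stdGaussian (EuclideanSpace ℝ (Fin d))).real
        (extremalDirections (column X) i) := by
  have hd : d ≠ 0 := (zero_lt_two.trans_le (hI.two_le_dim hcard)).ne'
  have hne : I.Nonempty := Finset.card_pos.1 (by omega)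
  have hcard0 : (0 : ℝ) < I.card := by exact_mod_cast hne.card_pos
  set γ : Fin n → ℝ := fun i => (stdGaussian (EuclideanSpace ℝ (Fin d))).real
    (maximizingDirections (column X) i)
  have hsolidAngle : ∀ i, solidAngle (normalCone (polytope X) (column X i)) = γ i := fun i => by
    rw [normalCone_polytope_column]
    exact solidAngle_eq_stdGaussian hd (measurableSet_maximizingDirections _ i)
      fun c hc w => smul_mem_maximizingDirections_iff _ i hc w
  obtain ⟨i₀, hi₀, hmin⟩ := I.exists_min_image γ hne
  have hmax : ⨆ i : I, (1 - 2 * γ i) = 1 - 2 * γ i₀ := by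
    have : Nonempty I := ⟨⟨i₀, hi₀⟩⟩
    exact le_antisymm (ciSup_le fun i => by linarith [hmin i i.2])
      (le_ciSup (f := fun i : I => 1 - 2 * γ i) (Set.finite_range _).bddAbove ⟨i₀, hi₀⟩)
  refine ⟨2 * γ i₀, mul_pos two_pos ?_, ?_, ?_, fun i hi => ?_⟩
  · exact stdGaussian_maximizingDirections_pos (hI.mapsTo hi₀)
  · have hsum : I.card • γ i₀ ≤ 1 := (Finset.card_nsmul_le_sum _ _ _ hmin).trans
      (sum_stdGaussian_maximizingDirections_le_one hI.injOn)
    rw [nsmul_eq_mul] at hsum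
    rw [le_div_iff₀ hcard0]
    linarith
  · simp only [conditionNumber, hsolidAngle, hmax]
    field_simp
  · obtain ⟨j, hj, hji⟩ := Finset.exists_mem_ne (show 1 < I.card by omega) i
    rw [stdGaussian_extremalDirections_eq_two_mul (hI.injOn.ne hi hj hji.symm)]
    linarith [hmin i hi]

end ExtremeIndexSet

section FailureProbability

theorem mul_one_sub_le_stdGaussian_extremalDirections_map {J E W : Type*} [Countable J]
    [NormedAddCommGroup E] [InnerProductSpace ℝ E] [FiniteDimensional ℝ E] [MeasurableSpace E]
    [BorelSpace E] [NormedAddCommGroup W] [InnerProductSpace ℝ W] [FiniteDimensional ℝ W]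
    [MeasurableSpace W] [BorelSpace W] (L : E →ₗ[ℝ] W) (x : J → E) (i : J) {q : ℝ} (hq : 0 < q)
    (hqi : q ≤ (stdGaussian E).real (extremalDirections x i)) :
    q * (1 - 8 * √(isometryDefect (L ∘ₗ (vectorSpan ℝ (Set.range x)).subtype)) *
        (1 + Real.log (1 / q))) ≤
      (stdGaussian W).real (extremalDirections (L ∘ x) i) := by
  set c := 8 * √(isometryDefect (L ∘ₗ (vectorSpan ℝ (Set.range x)).subtype))
  set γ := (stdGaussian E).real (extremalDirections x i)
  have hγ : 0 < γ := hq.trans_le hqi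
  rcases le_total (c * (1 + Real.log (1 / q))) 1 with hle | hle
  · calc q * (1 - c * (1 + Real.log (1 / q))) ≤ γ * (1 - c * (1 + Real.log (1 / q))) := by gcongr
      _ ≤ γ * (1 - c * (1 + Real.log (1 / γ))) := by gcongr
      _ ≤ (stdGaussian W).real (extremalDirections (L ∘ x) i) :=
        stdGaussian_extremalDirections_map_ge L x i
  · exact (mul_nonpos_of_nonneg_of_nonpos hq.le (sub_nonpos.2 hle)).trans measureReal_nonneg

variable {d n m B : ℕ} {X : Matrix (Fin d) (Fin n) ℝ} {I : Finset (Fin n)} {q δ : ℝ}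

/-- How far the CountSketch matrix with positions and signs `s` is from being an isometry on the
differences of the columns of `X`, which are all that the algorithm sees. -/
noncomputable def sketchDefect (X : Matrix (Fin d) (Fin n) ℝ) (s : Fin d → Fin B × Bool) : ℝ :=
  isometryDefect (sketchMap s ∘ₗ (vectorSpan ℝ (Set.range (column X))).subtype)

theorem conditionalFailure_le_mul_exp (hq : 0 < q) (hq1 : q ≤ 2 / 3)
    (hqI : ∀ i ∈ I, q ≤ (stdGaussian (EuclideanSpace ℝ (Fin d))).real
      (extremalDirections (column X) i))
    (hδ : 0 < δ) (hδI : δ ≤ I.card)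
    (hm : Real.log (I.card / δ) ≤ m * Real.log (1 / (1 - q))) (s : Fin d → Fin B × Bool) :
    conditionalFailure m X I s ≤ δ * Real.exp
      (3 * (8 * √(sketchDefect X s) * (1 + Real.log (1 / q))) * Real.log (I.card / δ)) := by
  set L := Real.log (I.card / δ) with hL
  set t := 8 * √(sketchDefect X s) * (1 + Real.log (1 / q)) with ht
  have hcard : (0 : ℝ) < I.card := hδ.trans_le hδI
  have hL0 : 0 ≤ L := Real.log_nonneg ((one_le_div hδ).2 hδI)
  have hlog : 0 ≤ Real.log (1 / q) := Real.log_nonneg ((one_le_div hq).2 (by linarith))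
  have hexp : Real.exp (-L) = δ / I.card := by
    rw [hL, Real.exp_neg, Real.exp_log (by positivity), inv_div]
  have hterm : ∀ i ∈ I, (1 - (stdGaussian (EuclideanSpace ℝ (Fin B))).real
      (extremalDirections (sketchMap s ∘ column X) i)) ^ m ≤
        δ / I.card * Real.exp (3 * t * L) := fun i hi => by
    rw [← hexp]
    exact one_sub_pow_le_exp hq.le hq1 (by positivity) measureReal_nonneg measureReal_le_one
      (mul_one_sub_le_stdGaussian_extremalDirections_map _ _ i hq (hqI i hi)) hL0 hm
  calc conditionalFailure m X I s
      ≤ ∑ _i ∈ I, δ / I.card * Real.exp (3 * t * L) :=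
        (conditionalFailure_le_sum s).trans (Finset.sum_le_sum hterm)
    _ = δ * Real.exp (3 * t * L) := by
        rw [Finset.sum_const, nsmul_eq_mul]
        field_simp

theorem conditionalFailure_le_add_sketchDefect (hcard : 3 ≤ I.card) (hq : 0 < q)
    (hqk : q ≤ 2 / I.card)
    (hqI : ∀ i ∈ I, q ≤ (stdGaussian (EuclideanSpace ℝ (Fin d))).real
      (extremalDirections (column X) i))
    (hδ : 0 < δ) (hδ1 : δ ≤ 1 / 2) (hm1 : 1 ≤ m)
    (hm : Real.log (I.card / δ) ≤ m * Real.log (1 / (1 - q))) (s : Fin d → Fin B × Bool) :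
    conditionalFailure m X I s ≤
      3 / 2 * δ + 25920000 * (1 + Real.log m) ^ 4 * sketchDefect X s := by
  have hcard' : (3 : ℝ) ≤ I.card := by exact_mod_cast hcard
  have hm1' : (1 : ℝ) ≤ m := by exact_mod_cast hm1
  have hq1 : q ≤ 2 / 3 := hqk.trans (by gcongr)
  set a := 1 + Real.log (1 / q)
  set L := Real.log (I.card / δ)
  set l := Real.log (1 / δ)
  have hdefect : 0 ≤ sketchDefect X s := isometryDefect_nonneg _
  have ha0 : 0 ≤ a := add_nonneg zero_le_one
    (Real.log_nonneg ((one_le_div hq).2 (by linarith)))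
  have hL0 : 0 ≤ L := Real.log_nonneg ((one_le_div hδ).2 (by linarith))
  have hl0 : 0 < l := Real.log_pos ((one_lt_div hδ).2 (by linarith))
  have hlogs : (a * L) ^ 2 / l ^ 2 ≤ 625 * (1 + Real.log m) ^ 4 := by
    rw [div_le_iff₀ (by positivity)]
    exact sq_mul_log_le hcard' hm1' hδ hδ1 hq hqk hm
  calc conditionalFailure m X I s
      ≤ 3 / 2 * δ + 72 * (3 * (8 * √(sketchDefect X s) * a) * L) ^ 2 / l ^ 2 :=
        le_add_sq_of_le_mul_exp hδ (by linarith) (by positivity) measureReal_le_one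
          (conditionalFailure_le_mul_exp hq hq1 hqI hδ (by linarith) hm s)
    _ = 3 / 2 * δ + 41472 * ((a * L) ^ 2 / l ^ 2) * √(sketchDefect X s) ^ 2 := by ring
    _ ≤ 3 / 2 * δ + 41472 * (625 * (1 + Real.log m) ^ 4) * √(sketchDefect X s) ^ 2 := by gcongr
    _ = 3 / 2 * δ + 25920000 * (1 + Real.log m) ^ 4 * sketchDefect X s := by
        rw [Real.sq_sqrt hdefect]
        ring

theorem IsExtremeIndexSet.expect_conditionalFailure_le [NeZero B] (hI : IsExtremeIndexSet X I)
    (hcard : 3 ≤ I.card) (hδ : 0 < δ) (hδ1 : δ ≤ 1 / 2) (hm1 : 1 ≤ m)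
    (hm : conditionNumber X I * I.card * Real.log (I.card / δ) ≤ m)
    (hB : 10 ^ 9 / δ * Module.finrank ℝ (vectorSpan ℝ (Set.range (column X))) ^ 2 *
      (1 + Real.log m) ^ 4 ≤ B) :
    𝔼 s : Fin d → Fin B × Bool, conditionalFailure m X I s ≤ 2 * δ := by
  have hB0 : (0 : ℝ) < B := Nat.cast_pos.2 (NeZero.pos B)
  have hcard' : (3 : ℝ) ≤ I.card := by exact_mod_cast hcard
  obtain ⟨q, hq, hqk, hκ, hqI⟩ := hI.exists_conditionNumber_eq hcard
  have hq1 : q ≤ 2 / 3 := hqk.trans (by gcongr)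
  have hlog : 0 < Real.log (1 / (1 - q)) := hq.trans_le (le_log_one_div_one_sub (by linarith))
  rw [hκ, one_div_mul_eq_div, div_le_iff₀ hlog] at hm
  set r := Module.finrank ℝ (vectorSpan ℝ (Set.range (column X)))
  set M := (1 + Real.log m) ^ 4
  have hM : 0 ≤ M := by positivity
  have hBM : 10 ^ 9 * (r ^ 2 * M) ≤ δ * B := by
    rw [div_mul_eq_mul_div, div_mul_eq_mul_div, div_le_iff₀ hδ] at hB
    linarith
  calc 𝔼 s : Fin d → Fin B × Bool, conditionalFailure m X I s
      ≤ 𝔼 s : Fin d → Fin B × Bool, (3 / 2 * δ + 25920000 * M * sketchDefect X s) :=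
        Finset.expect_le_expect fun s _ =>
          conditionalFailure_le_add_sketchDefect hcard hq hqk hqI hδ hδ1 hm1 hm s
    _ = 3 / 2 * δ + 25920000 * M * 𝔼 s : Fin d → Fin B × Bool, sketchDefect X s := by
        rw [Finset.expect_add_distrib, Fintype.expect_const, Finset.mul_expect]
    _ ≤ 3 / 2 * δ + 25920000 * M * (2 / B * r ^ 2) := by
        gcongr
        exact expect_isometryDefect_sketchMap_le _
    _ = 3 / 2 * δ + 51840000 * (r ^ 2 * M) / B := by ring
    _ ≤ 2 * δ := by
        have hbound : 51840000 * (r ^ 2 * M) / B ≤ δ / 2 := by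
          rw [div_le_iff₀ hB0]
          have : 0 ≤ r ^ 2 * M := by positivity
          linarith
        linarith

theorem IsExtremeIndexSet.sketch_size_le (hI : IsExtremeIndexSet X I) (hcard : 3 ≤ I.card)
    (hm : 1 ≤ m) {C : ℝ} (hC : 0 ≤ C) :
    C * Module.finrank ℝ (vectorSpan ℝ (Set.range (column X))) ^ 2 * (1 + Real.log m) ^ 4 ≤
      5 * 9 ^ 4 * C * Real.log d ^ 4 * (n : ℝ) ^ 2 * (m : ℝ) ^ (1 / 2 : ℝ) := by
  have hlog_d : 1 ≤ 5 * Real.log d ^ 4 := by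
    have hlog_two : 0.69 ≤ Real.log d := by
      have := Real.log_le_log two_pos (Nat.ofNat_le_cast.2 (hI.two_le_dim hcard))
      linarith [Real.log_two_gt_d9]
    nlinarith [pow_le_pow_left₀ (by norm_num) hlog_two 4]
  have hfinrank : Module.finrank ℝ (vectorSpan ℝ (Set.range (column X))) ≤ n := by
    obtain ⟨i, -⟩ := Finset.card_pos.1 (zero_lt_three.trans_le hcard)
    have : Nonempty (Fin n) := ⟨i⟩
    simpa only [Fintype.card_fin] using
      (Nat.le_succ _).trans (finrank_vectorSpan_range_add_one_le ℝ (column X))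
  calc C * Module.finrank ℝ (vectorSpan ℝ (Set.range (column X))) ^ 2 * (1 + Real.log m) ^ 4
      ≤ C * (n : ℝ) ^ 2 * (9 ^ 4 * (m : ℝ) ^ (1 / 2 : ℝ)) := by
        gcongr
        exact one_add_log_pow_four_le (by exact_mod_cast hm)
    _ ≤ 5 * Real.log d ^ 4 * (C * (n : ℝ) ^ 2 * (9 ^ 4 * (m : ℝ) ^ (1 / 2 : ℝ))) :=
        le_mul_of_one_le_left (by positivity) hlog_d
    _ = 5 * 9 ^ 4 * C * Real.log d ^ 4 * (n : ℝ) ^ 2 * (m : ℝ) ^ (1 / 2 : ℝ) := by ring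

end FailureProbability

end CountGauss

theorem mainTheorem3_general {d n m B : ℕ} {X : Matrix (Fin d) (Fin n) ℝ} {I : Finset (Fin n)}
    {δ : ℝ} (hI : CountGauss.IsExtremeIndexSet X I) (hδ : 0 < δ) (hm1 : 1 ≤ m)
    (hm : CountGauss.conditionNumber X I * I.card * Real.log (I.card / δ) ≤ m) (hB1 : 1 ≤ B)
    (hB : 3 ≤ I.card → 10 ^ 9 / δ *
      Module.finrank ℝ (vectorSpan ℝ (Set.range (CountGauss.column X))) ^ 2 *
        (1 + Real.log m) ^ 4 ≤ B) :
    ENNReal.ofReal (1 - 2 * δ) ≤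
      CountGauss.sampleLaw m B d {ω | (I : Set (Fin n)) ⊆ CountGauss.algorithmOutput X ω} := by
  have : NeZero B := ⟨Nat.one_le_iff_ne_zero.1 hB1⟩
  rcases le_or_gt I.card 2 with hcard | hcard
  · have huniv : {ω : CountGauss.Sample m B d |
        (I : Set (Fin n)) ⊆ CountGauss.algorithmOutput X ω} = Set.univ :=
      Set.eq_univ_of_forall (CountGauss.subset_algorithmOutput_of_card_le_two hI hcard hm1)
    rw [huniv, measure_univ]
    exact ENNReal.ofReal_le_one.2 (by linarith)
  rcases le_total (1 / 2) δ with hδ1 | hδ1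
  · rw [ENNReal.ofReal_of_nonpos (by linarith)]
    exact zero_le
  have hfailure := hI.expect_conditionalFailure_le hcard hδ hδ1 hm1 hm (hB hcard)
  rw [← CountGauss.sampleLaw_real_compl_eq_expect,
    probReal_compl_eq_one_sub CountGauss.measurableSet_subset_algorithmOutput] at hfailure
  refine ENNReal.ofReal_le_of_le_toReal ?_
  rw [← measureReal_def]
  linarith

theorem mainTheorem3 :
    ∃ C : ℝ, 1 < C ∧
      ∀ (d n k m B : ℕ) (X : Matrix (Fin d) (Fin n) ℝ) (I : Finset (Fin n)) (δ : ℝ),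
        CountGauss.IsSeparable X k I →
        CountGauss.IsExtremeIndexSet X I →
        0 < δ →
        1 ≤ m →
        CountGauss.conditionNumber X I * k * Real.log (k / δ) ≤ m →
        1 ≤ B →
        1 / δ * C * Real.log d ^ 4 * (n : ℝ) ^ 2 * (m : ℝ) ^ (1 / 2 : ℝ) ≤ B →
        ENNReal.ofReal (1 - 2 * δ) ≤
          CountGauss.sampleLaw m B d {ω | (I : Set (Fin n)) ⊆ CountGauss.algorithmOutput X ω} := by
  refine ⟨5 * 9 ^ 4 * 10 ^ 9, by norm_num, ?_⟩
  rintro d n _ m B X I δ ⟨rfl, -, -⟩ hI hδ hm1 hm hB1 hB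
  refine mainTheorem3_general hI hδ hm1 hm hB1 fun hcard => ?_
  exact (hI.sketch_size_le hcard hm1 (by positivity)).trans (le_of_eq_of_le (by ring) hB)
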